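/- **Theorem 3.1.** Let $E$ be a complex Banach space, $c\in\mathbb C$ with $|c|=1$, $\gamma\in(0,1)$, and let $(\alpha_n)$ be a strictly increasing sequence of positive reals tending to $+\infty$. *The operator.* Let $\mathcal A$ be a closed multivalued linear operator in $E$ satisfying condition (P): there are $a,M>0$ and $\beta\in(0,1]$ such that $\Psi=\{z\in\mathbb C:\operatorname{Re}z\ge -a(|\operatorname{Im}z|+1)\}$ is contained in the resolvent set of $\mathcal A$ and $\|(z-\mathcal A)^{-1}\|\le M(1+|z|)^{-\beta}$ for $z\in\Psi$. With $\Gamma$ the upwards oriented boundary of $\Psi$ and $\Phi_\gamma(s)=\sum_{k\ge0}\frac{(-s)^k}{k!\,\Gamma(1-\gamma-\gamma k)}$ the Wright function (where $1/\Gamma:=0$ at the poles of the Gamma function), put, for $t>0$, $$T(t)=\frac1{2\pi i}\int_{\Gamma}e^{zt}(z-\mathcal A)^{-1}\,dz,\qquad R_\gamma(t)=\gamma t^{\gamma-1}\int_0^\infty s\,\Phi_\gamma(s)\,T(st^\gamma)\,ds .$$ A mild solution of the inclusion $$D^{\gamma}_{t,+}u(t)\in\mathcal A u(t)+F(t,u(t)),\qquad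 t\in\mathbb R,$$ where $D^{\gamma}_{t,+}$ is the Riemann–Liouville fractional derivative of order $\gamma$, is a continuous $u:\mathbb R\to E$ with $u(t)=\int_{-\infty}^tR_\gamma(t-s)F(s,u(s))\,ds$ for all $t\in\mathbb R$ (the integrals being convergent as Bochner integrals). *Function spaces.* A continuous $f:\mathbb R\to E$ is $c$-uniformly recurrent if $\lim_n\sup_{t\in\mathbb R}\|f(t+\beta_n)-cf(t)\|=0$ for some strictly increasing sequence $(\beta_n)$ of positive reals tending to $+\infty$, and uniformly recurrent if this holds with $c=1$. $BUR_{(\alpha_n);c}(\mathbb R:E)$ is the set of bounded $c$-uniformly recurrent $f$ with $\lim_n\sup_{t\in\mathbb R}\|f(t+\alpha_n)-cf(t)\|=0$. $L^r_S(\mathbb R)$ is the set of $f\in L^r_{loc}(\mathbb R)$ with $\sup_{t\in\mathbb R}\int_t^{t+1}|f|^r\,ds<\infty$. *Hypotheses.* Let $F:\mathbb R\times E\to E$ satisfy: 1. for each bounded $B\subseteq E$ there is a finite $M_B>0$ with $\|F(t,y)\|\le M_B$ for all $t\in\mathbb R$, $y\in B$; 2. for some $p>1$, $F$ is Stepanov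 $(p,c)$-uniformly recurrent, that is, $F(\cdot,x)\in L^p_{loc}(\mathbb R:E)$ for each $x\in E$, and for each bounded $B\subseteq E$ there is a strictly increasing sequence $(\beta_n)$ of positive reals tending to $+\infty$ with $$\lim_{n\to\infty}\ \sup_{t\in\mathbb R}\ \sup_{x\in B}\int_t^{t+1}\bigl\|F(s+\beta_n,cx)-cF(s,x)\bigr\|^p\,ds=0;\tag{$*$}$$ moreover, for every bounded $B\subseteq E$, $(*)$ holds with $(\beta_n)$ replaced by the given sequence $(\alpha_n)$; 3. there are a real $r\ge\max\bigl(p,\frac p{p-1}\bigr)$ and $L_F\in L^r_S(\mathbb R)$ with $\|F(t,x)-F(t,y)\|\le L_F(t)\|x-y\|$ for all $t\in\mathbb R$, $x,y\in E$, and $q:=\frac{pr}{p+r}>1$; 4. $\dfrac{(\gamma-1)q}{q-1}>-1$; 5. there is an integer $n\ge1$ with $M_n<1$, where $$M_n:=\sup_{t\ge0}\int_{-\infty}^t\int_{-\infty}^{x_n}\cdots\int_{-\infty}^{x_2}\|R_\gamma(t-x_n)\|\prod_{i=2}^n\|R_\gamma(x_i-x_{i-1})\|\prod_{i=1}^nL_F(x_i)\,dx_1\,dx_2\cdots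 dx_n .$$ *Conclusion.* The inclusion has a unique bounded mild solution on $\mathbb R$. That solution is uniformly recurrent and belongs to $BUR_{(\alpha_n);c}(\mathbb R:E)$. -/

import Mathlib

open scoped ENNReal Topology

noncomputable section

namespace FracIncl

variable {E : Type*} [NormedAddCommGroup E] [NormedSpace ℂ E]

/-! ### `c`-uniform recurrence -/

/-- Strictly increasing sequences of positive real numbers tending to `+∞`. -/
structure IsRecurrenceSequence (α : ℕ → ℝ) : Prop where
  strictMono : StrictMono α
  pos : ∀ n, 0 < α n
  tendsto : Filter.Tendsto α Filter.atTop Filter.atTop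

/-- `‖f(· + αₙ) - c f(·)‖_∞ → 0` (the sup-norm is taken in `[0, ∞]`). -/
def RecurrentAlong (α : ℕ → ℝ) (c : ℂ) (f : ℝ → E) : Prop :=
  Filter.Tendsto (fun n => ⨆ t : ℝ, ‖f (t + α n) - c • f t‖ₑ) Filter.atTop (𝓝 0)

/-- The space `UR_c(ℝ : E)` of `c`-uniformly recurrent functions. -/
def UR (c : ℂ) : Set (ℝ → E) :=
  {f | Continuous f ∧ ∃ α, IsRecurrenceSequence α ∧ RecurrentAlong α c f}

/-- The space `BUR_{(αₙ);c}(ℝ : E)`. -/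
def BUR (α : ℕ → ℝ) (c : ℂ) : Set (ℝ → E) :=
  {f | f ∈ UR c ∧ Bornology.IsBounded (Set.range f) ∧ RecurrentAlong α c f}

/-! ### Stepanov classes -/

/-- `f ∈ L^p_loc(ℝ : G)`. -/
def MemLpLoc {G : Type*} [NormedAddCommGroup G] (p : ℝ) (f : ℝ → G) : Prop :=
  ∀ a b : ℝ, MeasureTheory.MemLp f (ENNReal.ofReal p)
    (MeasureTheory.volume.restrict (Set.Icc a b))

/-- `f ∈ L^p_S(ℝ : G)`: `f` is locally `p`-integrable and Stepanov `p`-bounded. -/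
def MemStepanov {G : Type*} [NormedAddCommGroup G] (p : ℝ) (f : ℝ → G) : Prop :=
  MemLpLoc p f ∧ (⨆ t : ℝ, (∫⁻ s in Set.Icc t (t + 1), ‖f s‖ₑ ^ p) ^ (1 / p)) < ∞

/-- `sup_{t ∈ ℝ} sup_{x ∈ B} ∫_t^{t+1} ‖F(s + αₙ, c x) - c F(s, x)‖^p ds → 0`. -/
def StepanovRecurrentAlong (α : ℕ → ℝ) (p : ℝ) (c : ℂ) (F : ℝ → E → E) (B : Set E) : Prop :=
  Filter.Tendsto
    (fun n => ⨆ t : ℝ, ⨆ x ∈ B,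
      ∫⁻ s in Set.Icc t (t + 1), ‖F (s + α n) (c • x) - c • F s x‖ₑ ^ p)
    Filter.atTop (𝓝 0)

/-- `F : ℝ × E → E` is Stepanov `(p,c)`-uniformly recurrent: the map
`F̂(t,x) = F(t + ·, x) ∈ L^p([0,1] : E)` is `c`-uniformly recurrent in `t`, uniformly for `x` in
bounded sets. -/
def StepanovUR (p : ℝ) (c : ℂ) (F : ℝ → E → E) : Prop :=
  (∀ x, MemLpLoc p (fun s => F s x)) ∧
    ∀ B : Set E, Bornology.IsBounded B →
      ∃ α, IsRecurrenceSequence α ∧ StepanovRecurrentAlong α p c F B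

/-! ### Multivalued linear operators

A multivalued linear operator `𝒜` in `E` is identified with its graph, a linear subspace of
`E × E`: `y ∈ 𝒜 x` means `(x, y) ∈ 𝒜`. -/

/-- `R` is the resolvent `(z - 𝒜)⁻¹`, everywhere defined, single-valued and bounded:
`x = R y` if and only if `y ∈ (z - 𝒜) x`. -/
def IsResolvent (A : Submodule ℂ (E × E)) (z : ℂ) (R : E →L[ℂ] E) : Prop :=
  ∀ x y : E, R y = x ↔ (x, z • x - y) ∈ A

/-- The resolvent set `ρ(𝒜)`. -/
def resolventSet (A : Submodule ℂ (E × E)) : Set ℂ :=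
  {z | ∃ R : E →L[ℂ] E, IsResolvent A z R}

open Classical in
/-- The resolvent `(z - 𝒜)⁻¹` (only meaningful for `z ∈ ρ(𝒜)`). -/
def resolvent (A : Submodule ℂ (E × E)) (z : ℂ) : E →L[ℂ] E :=
  if h : ∃ R : E →L[ℂ] E, IsResolvent A z R then h.choose else 0

theorem isResolvent_resolvent {A : Submodule ℂ (E × E)} {z : ℂ} (hz : z ∈ resolventSet A) :
    IsResolvent A z (resolvent A z) := by
  have h : ∃ R : E →L[ℂ] E, IsResolvent A z R := hz
  rw [resolvent, dif_pos h]
  exact h.choose_spec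

theorem IsResolvent.eq_resolvent {A : Submodule ℂ (E × E)} {z : ℂ} {R : E →L[ℂ] E}
    (hR : IsResolvent A z R) : resolvent A z = R := by
  ext y
  exact (isResolvent_resolvent ⟨R, hR⟩ _ y).2 ((hR _ y).1 rfl)

/-- Condition (P) with constants `a, M > 0` and `β ∈ (0,1]`: the region
`Ψ_a = {z : Re z ≥ -a (|Im z| + 1)}` is contained in `ρ(𝒜)` and
`‖(z - 𝒜)⁻¹‖ ≤ M (1 + |z|)^{-β}` on it. -/
structure ConditionP (A : Submodule ℂ (E × E)) (a M β : ℝ) : Prop where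
  a_pos : 0 < a
  M_pos : 0 < M
  β_pos : 0 < β
  β_le_one : β ≤ 1
  mem_resolventSet : ∀ z : ℂ, -a * (|z.im| + 1) ≤ z.re → z ∈ resolventSet A
  norm_resolvent_le : ∀ z : ℂ, -a * (|z.im| + 1) ≤ z.re →
    ‖resolvent A z‖ ≤ M * (1 + ‖z‖) ^ (-β)

/-! ### The operator family `(R_γ(t))_{t > 0}` -/

/-- The upwards oriented curve `Γ_a : η ↦ -a (|η| + 1) + i η`, the boundary of `Ψ_a`. -/
def contour (a η : ℝ) : ℂ := ((-a * (|η| + 1) : ℝ) : ℂ) + (η : ℂ) * Complex.I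

/-- The derivative of `contour a` at `η ≠ 0`. -/
def contourDeriv (a η : ℝ) : ℂ := ((-a * Real.sign η : ℝ) : ℂ) + Complex.I

/-- The degenerate semigroup generated by `𝒜`:
`T(t) = (2πi)⁻¹ ∫_{Γ_a} e^{zt} (z - 𝒜)⁻¹ dz`, `t > 0`. -/
def semigroup (A : Submodule ℂ (E × E)) (a t : ℝ) : E →L[ℂ] E :=
  (2 * (Real.pi : ℂ) * Complex.I)⁻¹ •
    ∫ η : ℝ, (Complex.exp ((t : ℂ) * contour a η) * contourDeriv a η) •
      resolvent A (contour a η)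

/-- The Wright function `Φ_γ(s) = ∑_{k ≥ 0} (-s)^k / (k! Γ(1 - γ - γk))`; here `1/Γ` vanishes
at the poles `0, -1, -2, …` of `Γ`. -/
def wright (γ s : ℝ) : ℝ :=
  ∑' k : ℕ, (-s) ^ k / (Nat.factorial k : ℝ) * (Real.Gamma (1 - γ - γ * k))⁻¹

/-- `R_γ(t) = γ t^{γ-1} ∫_0^∞ s Φ_γ(s) T(s t^γ) ds`, `t > 0`. -/
def fracResolvent (A : Submodule ℂ (E × E)) (a γ t : ℝ) : E →L[ℂ] E :=
  ((γ * t ^ (γ - 1) : ℝ) : ℂ) •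
    ∫ s in Set.Ioi (0 : ℝ), ((s * wright γ s : ℝ) : ℂ) • semigroup A a (s * t ^ γ)

/-- `u` is a mild solution of `D^γ_{t,+} u(t) ∈ 𝒜 u(t) + F(t, u(t))`, `t ∈ ℝ`: it is continuous
and `u(t) = ∫_{-∞}^t R_γ(t - s) F(s, u(s)) ds` for all `t`, the integral being convergent. -/
def IsMildSolution (A : Submodule ℂ (E × E)) (a γ : ℝ) (F : ℝ → E → E) (u : ℝ → E) : Prop :=
  Continuous u ∧ ∀ t : ℝ,
    MeasureTheory.IntegrableOn (fun s => fracResolvent A a γ (t - s) (F s (u s))) (Set.Iio t) ∧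
    u t = ∫ s in Set.Iio t, fracResolvent A a γ (t - s) (F s (u s))

/-- The iterated integral
`∫_{-∞}^t ∫_{-∞}^{x_n} ⋯ ∫_{-∞}^{x_2} ‖R(t - x_n)‖ ∏_{i=2}^n ‖R(x_i - x_{i-1})‖
∏_{i=1}^n L(x_i) dx_1 ⋯ dx_n`, computed in `[0, ∞]`; the factors that do not depend on the inner
variables stand outside of the inner integrals, and `n = 0` gives the value `1`. -/
def iteratedKernel (R : ℝ → E →L[ℂ] E) (L : ℝ → ℝ) : ℕ → ℝ → ℝ≥0∞
  | 0, _ => 1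
  | n + 1, t => ∫⁻ x in Set.Iio t,
      ‖R (t - x)‖ₑ * ENNReal.ofReal (L x) * iteratedKernel R L n x

/-- `M_n`, the supremum over `t ≥ 0` of the iterated integral. -/
def kernelConst (R : ℝ → E →L[ℂ] E) (L : ℝ → ℝ) (n : ℕ) : ℝ≥0∞ :=
  ⨆ t ∈ Set.Ici (0 : ℝ), iteratedKernel R L n t

end FracIncl

end

noncomputable section

namespace FracIncl

open MeasureTheory Set Filter BoundedContinuousFunction

/-! ### Wright function: ray integral representation, decay, integrability. -/

section

/-! ### The Gamma integral along a rotated ray -/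

/-! Bounded mild solutions are the bounded fixed points of `Φ f = k * F(·, f(·))`, where `k` is
`R_γ` extended by zero to the negative half-line. The kernel enters only through `k ∈ L¹`. This
holds because the Wright function and `T` are both integrable on `(0, ∞)`, and the substitution `τ =
s t^γ` bounds `∫ ‖R_γ‖` by the product of their integrals (`ConditionP.integrableOn_fracResolvent`).

An `L¹` kernel sends bounded functions to bounded uniformly continuous ones, and sends bounded
functions of small Stepanov norm to uniformly small ones (`exists_lintegral_kernel_mul_le`). Let
`σ_j f = c f(· - α_j)`. Recurrence of `F` along `α` then says that `σ_j` and `Φ` commute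
asymptotically, on each uniformly continuous function, and the same follows for iterates
(`tendsto_dist_twistedShift_iterate`).

This commutation is used twice. The constant `M_n` controls `Φ^n f - Φ^n g` only at times `t ≥ 0`,
but `σ_j` moves any given time into the positive half-line at a vanishing cost, so `Φ^n` contracts
in the sup norm over the whole line (`dist_iterate_le`). Banach's theorem on the uniformly
continuous functions gives the fixed point `u`. Moreover `σ_j u` is almost fixed by the contraction
`Φ^n`, so it is close to `u`: this is recurrence along `α`. Finally, powers of `c` return close to
`1`, so multiples of the `α_j` are almost periods, which yields uniform recurrence. -/

theorem integrableOn_rpow_mul_cexp {x : ℝ} (hx : 0 < x) {z : ℂ} (hz : 0 < z.re) :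
    IntegrableOn (fun ρ : ℝ => ((ρ ^ (x - 1) : ℝ) : ℂ) * Complex.exp (-z * ρ)) (Ioi 0) := by
  have h := integrableOn_rpow_mul_exp_neg_mul_rpow (p := 1) (s := x - 1) (b := z.re)
    (by linarith) one_pos hz
  refine Integrable.mono' h ?_ ?_
  · exact (Measurable.aestronglyMeasurable (by fun_prop))
  · filter_upwards [ae_restrict_mem measurableSet_Ioi] with ρ hρ
    have hρ' : (0 : ℝ) ≤ ρ ^ (x - 1) := Real.rpow_nonneg (le_of_lt hρ) _
    rw [norm_mul, Complex.norm_real, Real.norm_of_nonneg hρ', Complex.norm_exp]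
    simp

/-- Both sides are holomorphic in `z` on the right half-plane and agree on the positive reals; the
identity theorem is applied at `1`, along `1 + 1/(n+1)`. -/
theorem integral_rpow_mul_cexp {x : ℝ} (hx : 0 < x) {z : ℂ} (hz : 0 < z.re) :
    ∫ ρ in Ioi (0 : ℝ), ((ρ ^ (x - 1) : ℝ) : ℂ) * Complex.exp (-z * ρ)
      = z ^ (-(x : ℂ)) * (Real.Gamma x : ℂ) := by
  have hopen : IsOpen {w : ℂ | 0 < w.re} := isOpen_lt continuous_const Complex.continuous_re
  have hdiff : DifferentiableOn ℂ (fun z : ℂ => ∫ ρ in Ioi (0 : ℝ),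
      ((ρ ^ (x - 1) : ℝ) : ℂ) * Complex.exp (-z * ρ)) {w : ℂ | 0 < w.re} := by
    intro w hw
    have hw : 0 < w.re := hw
    have hb := integrableOn_rpow_mul_exp_neg_mul_rpow (p := 1) (s := x) (b := w.re / 2)
      (by linarith) one_pos (by linarith)
    refine (hasDerivAt_integral_of_dominated_loc_of_deriv_le
      (F := fun (z : ℂ) (ρ : ℝ) => ((ρ ^ (x - 1) : ℝ) : ℂ) * Complex.exp (-z * ρ))
      (F' := fun (z : ℂ) (ρ : ℝ) => ((ρ ^ (x - 1) : ℝ) : ℂ) * (Complex.exp (-z * ρ) * (-ρ)))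
      (s := {z : ℂ | w.re / 2 < z.re})
      (bound := fun ρ => ρ ^ x * Real.exp (-(w.re / 2) * ρ ^ (1 : ℝ)))
      ?_ ?_ (integrableOn_rpow_mul_cexp hx hw) ?_ ?_ hb ?_).2.differentiableAt.differentiableWithinAt
    · exact (isOpen_lt continuous_const Complex.continuous_re).mem_nhds
        (show w.re / 2 < w.re by linarith)
    · exact Eventually.of_forall fun z => Measurable.aestronglyMeasurable (by fun_prop)
    · exact Measurable.aestronglyMeasurable (by fun_prop)
    · filter_upwards [ae_restrict_mem measurableSet_Ioi] with ρ hρ z hz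
      have hρ0 : 0 < ρ := hρ
      have hρ' : (0 : ℝ) ≤ ρ ^ (x - 1) := Real.rpow_nonneg (le_of_lt hρ) _
      have hz : w.re / 2 < z.re := hz
      rw [norm_mul, norm_mul, Complex.norm_real, Real.norm_of_nonneg hρ', Complex.norm_exp,
        norm_neg, Complex.norm_real, Real.norm_of_nonneg hρ0.le, mul_comm (Real.exp _), ← mul_assoc,
        ← Real.rpow_add_one hρ0.ne', sub_add_cancel, Real.rpow_one]
      gcongr
      simp only [Complex.mul_re, Complex.neg_re, Complex.ofReal_re, Complex.ofReal_im, mul_zero,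
        sub_zero]
      nlinarith
    · refine Eventually.of_forall fun ρ z _ => ?_
      have h1 : HasDerivAt (fun z : ℂ => -z * (ρ : ℂ)) (-(ρ : ℂ)) z := by
        simpa using ((hasDerivAt_id z).neg.mul_const (ρ : ℂ))
      exact h1.cexp.const_mul _
  have hdiff2 : DifferentiableOn ℂ (fun z : ℂ => z ^ (-(x : ℂ)) * (Real.Gamma x : ℂ))
      {w : ℂ | 0 < w.re} := by
    intro w hw
    exact ((differentiableAt_id.cpow_const (Or.inl hw)).mul_const _).differentiableWithinAt
  have hconn : IsPreconnected {w : ℂ | 0 < w.re} :=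
    (convex_halfSpace_re_gt 0).isPreconnected
  have key := (hdiff.analyticOnNhd hopen).eqOn_of_preconnected_of_frequently_eq
    (hdiff2.analyticOnNhd hopen) hconn (z₀ := 1) (by simp) ?_
  · exact key hz
  · have ht : Tendsto (fun n : ℕ => ((1 + 1 / ((n : ℝ) + 1) : ℝ) : ℂ)) atTop (𝓝[≠] 1) := by
      refine tendsto_nhdsWithin_iff.2 ⟨?_, Eventually.of_forall fun n => ?_⟩
      · have := (tendsto_one_div_add_atTop_nhds_zero_nat (𝕜 := ℝ)).const_add 1
        rw [add_zero] at this
        exact (Complex.continuous_ofReal.tendsto' 1 1 (by simp)).comp this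
      · have : (0 : ℝ) < 1 / ((n : ℝ) + 1) := by positivity
        simp only [mem_compl_iff, mem_singleton_iff]
        intro h
        have h' : (1 + 1 / ((n : ℝ) + 1) : ℝ) = 1 := by exact_mod_cast h
        linarith
    refine ht.frequently (Frequently.of_forall fun n => ?_)
    set y : ℝ := 1 + 1 / ((n : ℝ) + 1) with hy
    have hy0 : 0 < y := by positivity
    have h := Real.integral_rpow_mul_exp_neg_mul_Ioi hx hy0
    have h2 : ∫ ρ in Ioi (0 : ℝ), ((ρ ^ (x - 1) : ℝ) : ℂ) * Complex.exp (-(y : ℂ) * ρ)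
        = ((∫ ρ in Ioi (0 : ℝ), ρ ^ (x - 1) * Real.exp (-(y * ρ)) : ℝ) : ℂ) := by
      rw [← integral_complex_ofReal]
      congr 1
      ext ρ
      push_cast
      ring_nf
    rw [h2, h, one_div, Real.inv_rpow hy0.le, ← Real.rpow_neg hy0.le]
    push_cast
    rw [Complex.ofReal_cpow hy0.le]
    push_cast
    rfl

/-! ### Integrability of the Wright function -/

theorem inv_Gamma_one_sub {x : ℝ} (hx : 0 < x) :
    (Real.Gamma (1 - x))⁻¹ = Real.Gamma x * Real.sin (Real.pi * x) / Real.pi := by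
  have h := Real.Gamma_mul_Gamma_one_sub x
  have hG := (Real.Gamma_pos_of_pos hx).ne'
  by_cases hs : Real.sin (Real.pi * x) = 0
  -- At integers `x` the reflection formula reads `Γ(x) Γ(1 - x) = π / 0 = 0`, so `Real.Gamma`
  -- vanishes at its poles and both sides are `0`.
  · rw [hs, div_zero] at h
    have : Real.Gamma (1 - x) = 0 := by simpa [hG] using h
    simp [hs, this]
  · have h0 : Real.Gamma (1 - x) ≠ 0 := by
      intro h0
      rw [h0, mul_zero] at h
      exact (div_ne_zero Real.pi_ne_zero hs) h.symm
    rw [eq_div_iff hs] at h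
    rw [eq_div_iff Real.pi_ne_zero, inv_mul_eq_iff_eq_mul₀ h0]
    exact h.symm.trans (by ring)

theorem norm_cexp_sub_one_le {z : ℂ} (hz : z.re ≤ 0) : ‖Complex.exp z - 1‖ ≤ ‖z‖ := by
  have h := (convex_halfSpace_re_le 0).norm_image_sub_le_of_norm_deriv_le (𝕜 := ℂ)
    (f := Complex.exp) (C := 1) (x := 0) (y := z) (fun x _ => Complex.differentiableAt_exp)
    (fun x hx => by
      rw [Complex.deriv_exp, Complex.norm_exp]
      exact Real.exp_le_one_iff.2 hx) (by simp) hz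
  simpa using h

/-- The rotated ray integral whose imaginary part is `π` times the Wright function. -/
def wrightIntegral (γ : ℝ) (κ ω : ℂ) (s : ℝ) : ℂ :=
  ∫ ρ in Ioi (0 : ℝ), ω * ((ρ ^ (γ - 1) : ℝ) : ℂ) * Complex.exp (-κ * ρ) *
    Complex.exp (-(s * ω) * ((ρ ^ γ : ℝ) : ℂ))

/-- Weighted AM-GM for `bρ` and `X`, with `X` chosen so that `X^(1-γ) = s / b^γ`. Since `γ < 1`,
linear exponential decay absorbs `exp (s ρ^γ)`. -/
theorem exists_mul_rpow_le {γ : ℝ} (hγ0 : 0 < γ) (hγ1 : γ < 1) {b s : ℝ} (hb : 0 < b)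
    (hs : 0 ≤ s) : ∃ C : ℝ, ∀ ρ : ℝ, 0 < ρ → s * ρ ^ γ ≤ b * ρ + C := by
  set X : ℝ := (s / b ^ γ) ^ (1 / (1 - γ)) with hX
  have h1γ : (1 - γ) ≠ 0 := by linarith
  have hX0 : 0 ≤ X := by positivity
  refine ⟨(1 - γ) * X, fun ρ hρ => ?_⟩
  have h := Real.geom_mean_le_arith_mean2_weighted hγ0.le (by linarith : 0 ≤ 1 - γ)
    (by positivity : 0 ≤ b * ρ) hX0 (by ring)
  have h2 : X ^ (1 - γ) = s / b ^ γ := by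
    rw [hX, ← Real.rpow_mul (by positivity), one_div, inv_mul_cancel₀ h1γ, Real.rpow_one]
  rw [h2, Real.mul_rpow hb.le hρ.le] at h
  have h3 : b ^ γ * ρ ^ γ * (s / b ^ γ) = s * ρ ^ γ := by
    have : b ^ γ ≠ 0 := by positivity
    field_simp
  rw [h3] at h
  nlinarith [mul_pos hb hρ]

theorem hasSum_wrightIntegral {γ : ℝ} (hγ0 : 0 < γ) (hγ1 : γ < 1) {κ ω : ℂ} (hκ : 0 < κ.re)
    (hω : ‖ω‖ = 1) {s : ℝ} (hs : 0 ≤ s) :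
    HasSum (fun k : ℕ => ∫ ρ in Ioi (0 : ℝ), ω * ((ρ ^ (γ - 1) : ℝ) : ℂ) * Complex.exp (-κ * ρ) *
      ((-(s * ω) * ((ρ ^ γ : ℝ) : ℂ)) ^ k / (k.factorial : ℂ))) (wrightIntegral γ κ ω s) := by
  have hsum : ∀ ρ : ℝ, HasSum (fun k : ℕ => ρ ^ (γ - 1) * Real.exp (-κ.re * ρ) *
      ((s * ρ ^ γ) ^ k / (k.factorial : ℝ)))
      (ρ ^ (γ - 1) * Real.exp (-κ.re * ρ) * Real.exp (s * ρ ^ γ)) := by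
    intro ρ
    have := NormedSpace.expSeries_div_hasSum_exp (s * ρ ^ γ)
    rw [← Real.exp_eq_exp_ℝ] at this
    exact this.mul_left _
  refine hasSum_integral_of_dominated_convergence
    (fun k ρ => ρ ^ (γ - 1) * Real.exp (-κ.re * ρ) * ((s * ρ ^ γ) ^ k / (k.factorial : ℝ)))
    ?_ ?_ ?_ ?_ ?_
  · exact fun k => Measurable.aestronglyMeasurable (by fun_prop)
  · intro k
    filter_upwards [ae_restrict_mem measurableSet_Ioi] with ρ hρ
    have hρ0 : 0 < ρ := hρ
    have h1 : (0 : ℝ) ≤ ρ ^ (γ - 1) := by positivity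
    have h2 : (0 : ℝ) ≤ ρ ^ γ := by positivity
    simp only [norm_mul, norm_div, norm_pow, norm_neg, Complex.norm_real, hω, Complex.norm_exp,
      Real.norm_of_nonneg h1, Real.norm_of_nonneg h2, Real.norm_of_nonneg hs, one_mul, mul_one,
      Complex.norm_natCast]
    simp
  · exact Eventually.of_forall fun ρ => (hsum ρ).summable
  · simp_rw [(hsum _).tsum_eq]
    obtain ⟨C, hC⟩ := exists_mul_rpow_le hγ0 hγ1 (half_pos hκ) hs
    have h := (integrableOn_rpow_mul_exp_neg_mul_rpow (p := 1) (s := γ - 1) (b := κ.re / 2)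
      (by linarith) one_pos (half_pos hκ)).mul_const (Real.exp C)
    refine Integrable.mono' h (Measurable.aestronglyMeasurable (by fun_prop)) ?_
    filter_upwards [ae_restrict_mem measurableSet_Ioi] with ρ hρ
    have hρ0 : 0 < ρ := hρ
    rw [Real.norm_of_nonneg (by positivity), mul_assoc, mul_assoc, ← Real.exp_add, ← Real.exp_add,
      Real.rpow_one]
    refine mul_le_mul_of_nonneg_left (Real.exp_le_exp.2 ?_) (by positivity)
    linarith [hC ρ hρ0]
  · refine Eventually.of_forall fun ρ => ?_
    have := NormedSpace.expSeries_div_hasSum_exp (-(s * ω) * ((ρ ^ γ : ℝ) : ℂ))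
    rw [← Complex.exp_eq_exp_ℂ] at this
    exact this.mul_left _

/-- Expanding the second exponential and integrating termwise produces `Γ(γ(k+1))`; the reflection
formula turns `1/Γ(1 - γ(k+1))` into this factor times `sin(πγ(k+1))/π`, the sine being an imaginary
part. -/
theorem wright_eq_im_wrightIntegral {γ : ℝ} (hγ0 : 0 < γ) (hγ1 : γ < 1) {φ : ℝ}
    (hφ : φ ∈ Ioo (-(Real.pi / 2)) (Real.pi / 2)) {s : ℝ} (hs : 0 ≤ s) :
    wright γ s = (wrightIntegral γ (Complex.exp (φ * Complex.I))
      (Complex.exp ((γ * (Real.pi + φ) : ℝ) * Complex.I)) s).im / Real.pi := by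
  set κ := Complex.exp (φ * Complex.I) with hκ
  set ω := Complex.exp ((γ * (Real.pi + φ) : ℝ) * Complex.I) with hω
  have hκre : 0 < κ.re := by
    rw [hκ, Complex.exp_ofReal_mul_I_re]
    exact Real.cos_pos_of_mem_Ioo hφ
  have h := hasSum_wrightIntegral (ω := ω) hγ0 hγ1 hκre (Complex.norm_exp_ofReal_mul_I _) hs
  have h2 := (Complex.hasSum_im h).div_const Real.pi
  rw [← h2.tsum_eq, wright]
  congr 1
  ext k
  have hx : 0 < γ * (k + 1) := by positivity
  rw [show 1 - γ - γ * k = 1 - γ * (k + 1) by ring, inv_Gamma_one_sub hx, ← mul_div_assoc]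
  congr 1
  have hint : ∫ ρ in Ioi (0 : ℝ), ω * ((ρ ^ (γ - 1) : ℝ) : ℂ) * Complex.exp (-κ * ρ) *
      ((-(s * ω) * ((ρ ^ γ : ℝ) : ℂ)) ^ k / (k.factorial : ℂ)) =
      (ω ^ (k + 1) * (((-s) ^ k / (k.factorial : ℝ) : ℝ) : ℂ)) *
        ∫ ρ in Ioi (0 : ℝ), ((ρ ^ (γ * (k + 1) - 1) : ℝ) : ℂ) * Complex.exp (-κ * ρ) := by
    rw [← integral_const_mul]
    refine setIntegral_congr_fun measurableSet_Ioi fun ρ hρ => ?_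
    have hρ0 : 0 < ρ := hρ
    have : ρ ^ (γ * (k + 1) - 1) = ρ ^ (γ - 1) * (ρ ^ γ) ^ k := by
      rw [← Real.rpow_natCast, ← Real.rpow_mul hρ0.le, ← Real.rpow_add hρ0]
      ring_nf
    simp only [this]
    push_cast
    ring
  rw [hint, integral_rpow_mul_cexp hx hκre]
  have hcpow : κ ^ (-((γ * (k + 1) : ℝ) : ℂ)) =
      Complex.exp ((-(φ * (γ * (k + 1))) : ℝ) * Complex.I) := by
    rw [hκ, Complex.cpow_def_of_ne_zero (Complex.exp_ne_zero _), Complex.log_exp]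
    · congr 1
      push_cast
      ring
    · simp only [Complex.mul_im, Complex.ofReal_re, Complex.I_im, mul_one, Complex.ofReal_im,
        Complex.I_re, mul_zero, add_zero]
      linarith [hφ.1, Real.pi_pos]
    · simp only [Complex.mul_im, Complex.ofReal_re, Complex.I_im, mul_one, Complex.ofReal_im,
        Complex.I_re, mul_zero, add_zero]
      linarith [hφ.2, Real.pi_pos]
  -- The angles of `κ` and `ω` are tied together so that `φ` cancels here, leaving `φ` free to be
  -- chosen for decay.
  have hmul : ω ^ (k + 1) * κ ^ (-((γ * (k + 1) : ℝ) : ℂ)) =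
      Complex.exp ((Real.pi * (γ * (k + 1)) : ℝ) * Complex.I) := by
    rw [hcpow, hω, ← Complex.exp_nat_mul, ← Complex.exp_add]
    congr 1
    push_cast
    ring
  have : ω ^ (k + 1) * (((-s) ^ k / (k.factorial : ℝ) : ℝ) : ℂ) *
      (κ ^ (-((γ * (k + 1) : ℝ) : ℂ)) * (Real.Gamma (γ * (k + 1)) : ℂ)) =
      (((-s) ^ k / (k.factorial : ℝ) * Real.Gamma (γ * (k + 1)) : ℝ) : ℂ) *
        Complex.exp ((Real.pi * (γ * (k + 1)) : ℝ) * Complex.I) := by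
    rw [← hmul]
    push_cast
    ring
  rw [this, Complex.im_ofReal_mul, Complex.exp_ofReal_mul_I_im]
  ring

/-- Substitute `y = ρ^γ`. The prefactor `ω` makes the value real, so subtracting this integral
leaves imaginary parts unchanged. -/
theorem integral_rpow_mul_cexp_rpow {γ : ℝ} (hγ0 : 0 < γ) {ω : ℂ} (hω : 0 < ω.re) {s : ℝ}
    (hs : 0 < s) :
    IntegrableOn (fun ρ : ℝ => ω * ((ρ ^ (γ - 1) : ℝ) : ℂ) *
      Complex.exp (-(s * ω) * ((ρ ^ γ : ℝ) : ℂ))) (Ioi 0) ∧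
    ∫ ρ in Ioi (0 : ℝ), ω * ((ρ ^ (γ - 1) : ℝ) : ℂ) *
      Complex.exp (-(s * ω) * ((ρ ^ γ : ℝ) : ℂ)) = ((1 / (γ * s) : ℝ) : ℂ) := by
  have hre : (-(s * ω)).re < 0 := by
    simp only [Complex.neg_re, Complex.re_ofReal_mul]
    nlinarith
  have hω0 : ω ≠ 0 := by
    rintro rfl
    simp at hω
  have hfun : (fun ρ : ℝ => ω * ((ρ ^ (γ - 1) : ℝ) : ℂ) *
      Complex.exp (-(s * ω) * ((ρ ^ γ : ℝ) : ℂ))) = fun ρ : ℝ => (ω / γ) *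
      ((|γ| * ρ ^ (γ - 1)) • (fun y : ℝ => Complex.exp (-(s * ω) * (y : ℂ))) (ρ ^ γ)) := by
    ext ρ
    have : (γ : ℂ) ≠ 0 := by exact_mod_cast hγ0.ne'
    simp only [abs_of_pos hγ0, Complex.real_smul]
    push_cast
    field_simp
  constructor
  · rw [hfun]
    exact ((integrableOn_Ioi_comp_rpow_iff _ hγ0.ne').2
      (integrableOn_exp_mul_complex_Ioi hre 0)).const_mul _
  · rw [hfun, integral_const_mul,
      integral_comp_rpow_Ioi (fun y : ℝ => Complex.exp (-(s * ω) * (y : ℂ))) hγ0.ne',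
      integral_exp_mul_complex_Ioi hre 0]
    have : (γ : ℂ) ≠ 0 := by exact_mod_cast hγ0.ne'
    have : (s : ℂ) ≠ 0 := by exact_mod_cast hs.ne'
    push_cast
    simp
    field_simp

theorem norm_rpow_mul_cexp_mul_cexp {γ : ℝ} {ω : ℂ} (hω1 : ‖ω‖ = 1) {s ρ : ℝ}
    (hρ : 0 < ρ) (z : ℂ) :
    ‖ω * ((ρ ^ (γ - 1) : ℝ) : ℂ) * z * Complex.exp (-(s * ω) * ((ρ ^ γ : ℝ) : ℂ))‖ =
      ρ ^ (γ - 1) * ‖z‖ * Real.exp (-(s * ω.re) * ρ ^ γ) := by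
  have h1 : (0 : ℝ) ≤ ρ ^ (γ - 1) := by positivity
  rw [norm_mul, norm_mul, norm_mul, hω1, Complex.norm_real, Real.norm_of_nonneg h1, one_mul,
    Complex.norm_exp, Complex.re_mul_ofReal, Complex.neg_re, Complex.re_ofReal_mul]

theorem integrableOn_wrightIntegrand {γ : ℝ} (hγ0 : 0 < γ) {κ ω : ℂ} (hκ : 0 < κ.re)
    (hω : 0 < ω.re) {s : ℝ} (hs : 0 ≤ s) :
    IntegrableOn (fun ρ : ℝ => ω * ((ρ ^ (γ - 1) : ℝ) : ℂ) * Complex.exp (-κ * ρ) *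
      Complex.exp (-(s * ω) * ((ρ ^ γ : ℝ) : ℂ))) (Ioi 0) := by
  have h := ((integrableOn_rpow_mul_cexp hγ0 hκ).const_mul ω)
  simp only [← mul_assoc] at h
  refine Integrable.mono h (Measurable.aestronglyMeasurable (by fun_prop)) ?_
  filter_upwards [ae_restrict_mem measurableSet_Ioi] with ρ hρ
  have hρ0 : 0 < ρ := hρ
  rw [norm_mul]
  refine mul_le_of_le_one_right (norm_nonneg _) ?_
  rw [Complex.norm_exp, Complex.re_mul_ofReal, Complex.neg_re, Complex.re_ofReal_mul,
    Real.exp_le_one_iff]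
  have : 0 ≤ s * ω.re * ρ ^ γ := by positivity
  linarith

theorem norm_wrightIntegral_le {γ : ℝ} (hγ0 : 0 < γ) {κ ω : ℂ} (hκ : 0 < κ.re)
    (hω : 0 < ω.re) (hω1 : ‖ω‖ = 1) {s : ℝ} (hs : 0 ≤ s) :
    ‖wrightIntegral γ κ ω s‖ ≤ ∫ ρ in Ioi (0 : ℝ), ρ ^ (γ - 1) * Real.exp (-κ.re * ρ) := by
  have h := integrableOn_rpow_mul_exp_neg_mul_rpow (p := 1) (s := γ - 1) (b := κ.re)
    (by linarith) one_pos hκ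
  simp only [Real.rpow_one] at h
  refine norm_integral_le_of_norm_le h ?_
  filter_upwards [ae_restrict_mem measurableSet_Ioi] with ρ hρ
  have hρ0 : 0 < ρ := hρ
  rw [norm_rpow_mul_cexp_mul_cexp hω1 hρ0, Complex.norm_exp, Complex.re_mul_ofReal,
    Complex.neg_re]
  refine mul_le_of_le_one_right (by positivity) ?_
  rw [Real.exp_le_one_iff]
  have : 0 ≤ s * ω.re * ρ ^ γ := by positivity
  linarith

/-- Replacing `exp (-κρ)` by `exp (-κρ) - 1` changes the integral by a real number only, and gains a
factor `ρ`. The resulting decay of order `s^(-1-1/γ)` is integrable at infinity. -/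
theorem abs_im_wrightIntegral_le {γ : ℝ} (hγ0 : 0 < γ) {κ ω : ℂ} (hκ : 0 < κ.re)
    (hκ1 : ‖κ‖ = 1) (hω : 0 < ω.re) (hω1 : ‖ω‖ = 1) {s : ℝ} (hs : 0 < s) :
    |(wrightIntegral γ κ ω s).im| ≤
      (s * ω.re) ^ (-(γ + 1) / γ) * (1 / γ) * Real.Gamma ((γ + 1) / γ) := by
  obtain ⟨hi, hv⟩ := integral_rpow_mul_cexp_rpow hγ0 hω hs
  have hsub : (wrightIntegral γ κ ω s).im = (∫ ρ in Ioi (0 : ℝ), ω * ((ρ ^ (γ - 1) : ℝ) : ℂ) *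
      (Complex.exp (-κ * ρ) - 1) * Complex.exp (-(s * ω) * ((ρ ^ γ : ℝ) : ℂ))).im := by
    have : ∫ ρ in Ioi (0 : ℝ), ω * ((ρ ^ (γ - 1) : ℝ) : ℂ) *
        (Complex.exp (-κ * ρ) - 1) * Complex.exp (-(s * ω) * ((ρ ^ γ : ℝ) : ℂ)) =
        wrightIntegral γ κ ω s - ((1 / (γ * s) : ℝ) : ℂ) := by
      rw [← hv, wrightIntegral, ← integral_sub (integrableOn_wrightIntegrand hγ0 hκ hω hs.le) hi]
      congr 1
      ext ρ
      ring
    rw [this, Complex.sub_im, Complex.ofReal_im, sub_zero]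
  have hsω : 0 < s * ω.re := mul_pos hs hω
  rw [hsub, ← integral_rpow_mul_exp_neg_mul_rpow hγ0 (by linarith : (-1 : ℝ) < γ) hsω]
  refine (Complex.abs_im_le_norm _).trans (norm_integral_le_of_norm_le
    (integrableOn_rpow_mul_exp_neg_mul_rpow (by linarith) hγ0 hsω) ?_)
  filter_upwards [ae_restrict_mem measurableSet_Ioi] with ρ hρ
  have hρ0 : 0 < ρ := hρ
  rw [norm_rpow_mul_cexp_mul_cexp hω1 hρ0]
  have h1 : ‖Complex.exp (-κ * ρ) - 1‖ ≤ ρ := by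
    refine (norm_cexp_sub_one_le ?_).trans_eq ?_
    · rw [Complex.re_mul_ofReal, Complex.neg_re]
      nlinarith
    · rw [norm_mul, norm_neg, hκ1, one_mul, Complex.norm_real, Real.norm_of_nonneg hρ0.le]
  have h2 : ρ ^ γ = ρ ^ (γ - 1) * ρ := by
    rw [← Real.rpow_add_one hρ0.ne', sub_add_cancel]
  calc ρ ^ (γ - 1) * ‖Complex.exp (-κ * ρ) - 1‖ * Real.exp (-(s * ω.re) * ρ ^ γ)
      ≤ ρ ^ (γ - 1) * ρ * Real.exp (-(s * ω.re) * ρ ^ γ) := by gcongr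
    _ = ρ ^ γ * Real.exp (-(s * ω.re) * ρ ^ γ) := by rw [← h2]

theorem measurable_wrightIntegral (γ : ℝ) (κ ω : ℂ) : Measurable (wrightIntegral γ κ ω) := by
  refine (StronglyMeasurable.integral_prod_right ?_).measurable
  exact Measurable.stronglyMeasurable (by fun_prop)

/-- The Wright function agrees on `(0, ∞)` with a measurable integrable function. -/
theorem exists_integrable_eqOn_wright {γ : ℝ} (hγ0 : 0 < γ) (hγ1 : γ < 1) :
    ∃ W : ℝ → ℝ, Measurable W ∧ IntegrableOn W (Ioi 0) ∧ EqOn (wright γ) W (Ioi 0) := by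
  have hpi := Real.pi_pos
  -- With this angle `κ` has argument `-πγ/2` and `ω` has argument `(π/2)(1 - (1-γ)²)`, so both lie
  -- in the open right half-plane for every `γ ∈ (0,1)`. Without rotation `ω` would leave it once `γ
  -- ≥ 1/2`.
  set φ : ℝ := -(Real.pi * γ / 2) with hφdef
  have hφ : φ ∈ Ioo (-(Real.pi / 2)) (Real.pi / 2) := by
    constructor <;> rw [hφdef] <;> nlinarith [mul_pos hpi hγ0]
  set κ := Complex.exp (φ * Complex.I) with hκ
  set ω := Complex.exp ((γ * (Real.pi + φ) : ℝ) * Complex.I) with hω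
  have hκre : 0 < κ.re := by
    rw [hκ, Complex.exp_ofReal_mul_I_re]
    exact Real.cos_pos_of_mem_Ioo hφ
  have hωre : 0 < ω.re := by
    rw [hω, Complex.exp_ofReal_mul_I_re]
    have h1 : γ * (Real.pi + φ) = Real.pi / 2 * (1 - (1 - γ) ^ 2) := by rw [hφdef]; ring
    have h2 : 0 < (1 - γ) ^ 2 := by nlinarith
    have h3 : (1 - γ) ^ 2 < 1 := by nlinarith
    refine Real.cos_pos_of_mem_Ioo ⟨?_, ?_⟩ <;> rw [h1] <;> nlinarith
  have hκ1 : ‖κ‖ = 1 := Complex.norm_exp_ofReal_mul_I _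
  have hω1 : ‖ω‖ = 1 := Complex.norm_exp_ofReal_mul_I _
  have hmeas : Measurable fun s => (wrightIntegral γ κ ω s).im / Real.pi :=
    (Complex.measurable_im.comp (measurable_wrightIntegral γ κ ω)).div_const _
  refine ⟨fun s => (wrightIntegral γ κ ω s).im / Real.pi, hmeas, ?_, fun s hs =>
    wright_eq_im_wrightIntegral hγ0 hγ1 hφ (le_of_lt hs)⟩
  refine Integrable.div_const ?_ _
  have hm := Complex.measurable_im.comp (measurable_wrightIntegral γ κ ω)
  rw [← IntegrableOn, ← Ioc_union_Ioi_eq_Ioi (zero_le_one' ℝ), integrableOn_union]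
  constructor
  · refine Measure.integrableOn_of_bounded (M := ∫ ρ in Ioi (0 : ℝ), ρ ^ (γ - 1) *
      Real.exp (-κ.re * ρ)) (by simp) hm.aestronglyMeasurable ?_
    filter_upwards [ae_restrict_mem measurableSet_Ioc] with s hs
    exact (Complex.abs_im_le_norm _).trans (norm_wrightIntegral_le hγ0 hκre hωre hω1 hs.1.le)
  · have hexp : -(γ + 1) / γ < -1 := by
      rw [div_lt_iff₀ hγ0]
      linarith
    have hint := ((integrableOn_Ioi_rpow_of_lt hexp one_pos).const_mul (ω.re ^ (-(γ + 1) / γ) *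
      (1 / γ) * Real.Gamma ((γ + 1) / γ)))
    refine Integrable.mono' hint hm.aestronglyMeasurable ?_
    filter_upwards [ae_restrict_mem measurableSet_Ioi] with s hs
    have hs0 : (0 : ℝ) < s := lt_trans one_pos hs
    refine (abs_im_wrightIntegral_le hγ0 hκre hκ1 hωre hω1 hs0).trans_eq ?_
    rw [Real.mul_rpow hs0.le hωre.le]
    ring

end

/-! ### Integrability of `T` and of `R_γ` on the positive half-line. -/

section

variable {E : Type*} [NormedAddCommGroup E] [NormedSpace ℂ E]

/-! ### Continuity of the resolvent and integrability of the semigroup -/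

/-- From `y ∈ (w - 𝒜) x` with `x = (w - 𝒜)⁻¹ y` one gets `y + (z - w) x ∈ (z - 𝒜) x`; this needs
only the graph, so multivaluedness is harmless. -/
theorem resolvent_identity {A : Submodule ℂ (E × E)} {z w : ℂ} (hz : z ∈ resolventSet A)
    (hw : w ∈ resolventSet A) :
    resolvent A z - resolvent A w = (w - z) • (resolvent A z).comp (resolvent A w) := by
  ext y
  have h1 := (isResolvent_resolvent hw (resolvent A w y) y).1 rfl
  have h2 := (isResolvent_resolvent hz (resolvent A w y) (y + (z - w) • resolvent A w y)).2 (by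
    convert h1 using 2
    module)
  rw [map_add, map_smul] at h2
  simp only [_root_.sub_apply, _root_.smul_apply, ContinuousLinearMap.comp_apply]
  rw [eq_sub_of_add_eq h2]
  module

theorem ConditionP.norm_resolvent_le_const {A : Submodule ℂ (E × E)} {a M β : ℝ}
    (hP : ConditionP A a M β) {z : ℂ} (hz : -a * (|z.im| + 1) ≤ z.re) :
    ‖resolvent A z‖ ≤ M := by
  refine (hP.norm_resolvent_le z hz).trans (mul_le_of_le_one_right hP.M_pos.le ?_)
  exact Real.rpow_le_one_of_one_le_of_nonpos (by linarith [norm_nonneg z]) (by linarith [hP.β_pos])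

theorem ConditionP.continuousOn_resolvent {A : Submodule ℂ (E × E)} {a M β : ℝ}
    (hP : ConditionP A a M β) :
    ContinuousOn (resolvent A) {z | -a * (|z.im| + 1) ≤ z.re} := by
  have hM := hP.M_pos.le
  refine LipschitzOnWith.continuousOn (K := Real.toNNReal (M * M))
    (LipschitzOnWith.of_dist_le_mul fun z hz w hw => ?_)
  rw [dist_eq_norm, resolvent_identity (hP.mem_resolventSet z hz) (hP.mem_resolventSet w hw),
    norm_smul, Real.coe_toNNReal _ (by positivity), dist_comm, dist_eq_norm, mul_comm]
  gcongr
  exact (ContinuousLinearMap.opNorm_comp_le _ _).trans (mul_le_mul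
    (hP.norm_resolvent_le_const hz) (hP.norm_resolvent_le_const hw) (norm_nonneg _) hM)

theorem contour_re (a η : ℝ) : (contour a η).re = -a * (|η| + 1) := by
  simp [contour]

theorem contour_im (a η : ℝ) : (contour a η).im = η := by
  simp [contour]

theorem continuous_contour (a : ℝ) : Continuous (contour a) := by
  unfold contour
  fun_prop

theorem measurable_real_sign : Measurable Real.sign := by
  unfold Real.sign
  exact Measurable.ite measurableSet_Iio measurable_const
    (Measurable.ite measurableSet_Ioi measurable_const measurable_const)

theorem measurable_contourDeriv (a : ℝ) : Measurable (contourDeriv a) := by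
  unfold contourDeriv
  have := measurable_real_sign
  fun_prop

theorem norm_contourDeriv_le {a : ℝ} (ha : 0 < a) (η : ℝ) : ‖contourDeriv a η‖ ≤ a + 1 := by
  refine (norm_add_le _ _).trans ?_
  rw [Complex.norm_I, Complex.norm_real, norm_mul, norm_neg, Real.norm_of_nonneg ha.le]
  have : ‖Real.sign η‖ ≤ 1 := by
    rcases Real.sign_apply_eq η with h | h | h <;> simp [h]
  nlinarith

theorem ConditionP.continuous_resolvent_contour {A : Submodule ℂ (E × E)} {a M β : ℝ}
    (hP : ConditionP A a M β) : Continuous fun η => resolvent A (contour a η) :=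
  hP.continuousOn_resolvent.comp_continuous (continuous_contour a) fun η => by
    simp [contour_re, contour_im]

theorem ConditionP.stronglyMeasurable_semigroup {A : Submodule ℂ (E × E)} {a M β : ℝ}
    (hP : ConditionP A a M β) : StronglyMeasurable (semigroup A a) := by
  suffices h : StronglyMeasurable fun t : ℝ => ∫ η : ℝ, (Complex.exp ((t : ℂ) * contour a η) *
      contourDeriv a η) • resolvent A (contour a η) from
    h.const_smul (2 * (Real.pi : ℂ) * Complex.I)⁻¹
  refine StronglyMeasurable.integral_prod_right (ν := volume)
    (f := fun (t η : ℝ) => (Complex.exp ((t : ℂ) * contour a η) * contourDeriv a η) •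
      resolvent A (contour a η)) ?_
  have h1 : Measurable fun p : ℝ × ℝ => Complex.exp ((p.1 : ℂ) * contour a p.2) *
      contourDeriv a p.2 := by
    have := (continuous_contour a).measurable
    have := measurable_contourDeriv a
    fun_prop
  exact h1.stronglyMeasurable.smul
    (hP.continuous_resolvent_contour.stronglyMeasurable.comp_measurable measurable_snd)

theorem ConditionP.norm_semigroup_integrand_le {A : Submodule ℂ (E × E)} {a M β : ℝ}
    (hP : ConditionP A a M β) (t η : ℝ) :
    ‖(Complex.exp ((t : ℂ) * contour a η) * contourDeriv a η) • resolvent A (contour a η)‖ ≤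
      Real.exp (-(a * (1 + |η|)) * t) * ((a + 1) * (M * (1 + |η|) ^ (-β))) := by
  have hM := hP.M_pos.le
  have ha := hP.a_pos
  rw [norm_smul, norm_mul, Complex.norm_exp, Complex.re_ofReal_mul, contour_re, mul_assoc]
  refine mul_le_mul (le_of_eq (by ring_nf)) ?_ (by positivity) (by positivity)
  refine mul_le_mul (norm_contourDeriv_le ha η) ?_ (by positivity) (by positivity)
  refine (hP.norm_resolvent_le _ (by simp [contour_re, contour_im])).trans ?_
  refine mul_le_mul_of_nonneg_left (Real.rpow_le_rpow_of_nonpos (by positivity) ?_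
    (by linarith [hP.β_pos])) hM
  have := Complex.abs_im_le_norm (contour a η)
  rw [contour_im] at this
  linarith

/-- By Tonelli the `t`-integral can be taken first: it equals `1/(a(1+|η|))`, and together with the
resolvent bound leaves `(1+|η|)^(-1-β)`, integrable because `β > 0`. -/
theorem ConditionP.lintegral_semigroup_lt_top {A : Submodule ℂ (E × E)} {a M β : ℝ}
    (hP : ConditionP A a M β) : ∫⁻ t in Ioi (0 : ℝ), ‖semigroup A a t‖ₑ < ∞ := by
  have hM := hP.M_pos.le
  have ha := hP.a_pos
  set D : ℝ → ℝ := fun η => (a + 1) * (M * (1 + |η|) ^ (-β)) with hD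
  have hD0 : ∀ η, 0 ≤ D η := fun η => by positivity
  have hDm : Measurable D := by fun_prop
  have hle : ∀ t : ℝ, ‖semigroup A a t‖ₑ ≤ ‖(2 * (Real.pi : ℂ) * Complex.I)⁻¹‖ₑ *
      ∫⁻ η : ℝ, ENNReal.ofReal (Real.exp (-(a * (1 + |η|)) * t) * D η) := by
    intro t
    rw [semigroup, enorm_smul]
    gcongr
    refine (enorm_integral_le_lintegral_enorm _).trans (lintegral_mono fun η => ?_)
    rw [← ofReal_norm]
    exact ENNReal.ofReal_le_ofReal (hP.norm_semigroup_integrand_le t η)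
  refine (lintegral_mono hle).trans_lt ?_
  rw [lintegral_const_mul' _ _ enorm_ne_top, lintegral_lintegral_swap
    (Measurable.aemeasurable (by fun_prop))]
  refine ENNReal.mul_lt_top enorm_lt_top ?_
  have hint : Integrable (fun η : ℝ => (a + 1) * M / a * (1 + ‖η‖) ^ (-(β + 1))) :=
    (integrable_one_add_norm (by simp [hP.β_pos])).const_mul _
  refine lt_of_eq_of_lt (lintegral_congr fun η => ?_) hint.lintegral_lt_top
  have hc : 0 < a * (1 + |η|) := by positivity
  have hexp : ∫⁻ t in Ioi (0 : ℝ), ENNReal.ofReal (Real.exp (-(a * (1 + |η|)) * t)) =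
      ENNReal.ofReal (1 / (a * (1 + |η|))) := by
    rw [← ofReal_integral_eq_lintegral_ofReal (integrableOn_exp_mul_Ioi (by linarith) 0)
      (Eventually.of_forall fun t => (Real.exp_pos _).le), integral_exp_mul_Ioi (by linarith) 0]
    congr 1
    simp [neg_div_neg_eq]
  simp_rw [ENNReal.ofReal_mul (Real.exp_pos _).le]
  rw [lintegral_mul_const' _ _ ENNReal.ofReal_ne_top, hexp, ← ENNReal.ofReal_mul (by positivity)]
  congr 1
  rw [hD, Real.norm_eq_abs, neg_add, Real.rpow_add (by positivity), Real.rpow_neg_one]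
  field_simp

/-! ### Integrability of the fractional resolvent family -/

theorem lintegral_comp_mul_rpow_le {γ : ℝ} (hγ : 0 < γ) {s : ℝ} (hs : 0 < s) (g : ℝ → ℝ≥0∞) :
    ∫⁻ t in Ioi (0 : ℝ), ENNReal.ofReal (s * (γ * t ^ (γ - 1))) * g (s * t ^ γ) ≤
      ∫⁻ τ in Ioi (0 : ℝ), g τ := by
  have hinj : InjOn (fun t : ℝ => s * t ^ γ) (Ioi 0) := by
    intro x hx y hy hxy
    exact (Real.rpow_left_injOn hγ.ne') (mem_Ioi.1 hx).le (mem_Ioi.1 hy).le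
      (mul_left_cancel₀ hs.ne' hxy)
  have h := lintegral_image_eq_lintegral_abs_deriv_mul (f' := fun t => s * (γ * t ^ (γ - 1)))
    measurableSet_Ioi (fun t ht => ((Real.hasDerivAt_rpow_const
      (Or.inl (ne_of_gt ht))).const_mul s).hasDerivWithinAt) hinj g
  calc _ = ∫⁻ t in Ioi (0 : ℝ), ENNReal.ofReal |s * (γ * t ^ (γ - 1))| * g (s * t ^ γ) := by
        refine setLIntegral_congr_fun measurableSet_Ioi fun t ht => ?_
        have ht0 : (0 : ℝ) < t := ht
        rw [abs_of_nonneg (by positivity)]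
    _ = ∫⁻ τ in (fun t : ℝ => s * t ^ γ) '' Ioi 0, g τ := h.symm
    _ ≤ _ := by
        refine lintegral_mono_set ?_
        rintro _ ⟨t, ht, rfl⟩
        have ht0 : (0 : ℝ) < t := ht
        show 0 < s * t ^ γ
        positivity

/-- For fixed `s`, the weight `s γ t^(γ-1) dt` is exactly `dτ` for `τ = s t^γ`, so the singular
prefactor is absorbed. The measurable `W` stands in for the series `wright`. -/
theorem ConditionP.integrableOn_fracResolvent {A : Submodule ℂ (E × E)} {a M β : ℝ}
    (hP : ConditionP A a M β) {γ : ℝ} (hγ0 : 0 < γ) (hγ1 : γ < 1) :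
    IntegrableOn (fracResolvent A a γ) (Ioi 0) := by
  obtain ⟨W, hWm, hWi, hW⟩ := exists_integrable_eqOn_wright hγ0 hγ1
  have hT := hP.stronglyMeasurable_semigroup
  have hfun : fracResolvent A a γ = fun t => ((γ * t ^ (γ - 1) : ℝ) : ℂ) •
      ∫ s in Ioi (0 : ℝ), ((s * W s : ℝ) : ℂ) • semigroup A a (s * t ^ γ) := by
    ext1 t
    rw [fracResolvent]
    congr 1
    refine setIntegral_congr_fun measurableSet_Ioi fun s hs => ?_
    simp only [hW hs]
  have hsm : StronglyMeasurable fun p : ℝ × ℝ => semigroup A a (p.2 * p.1 ^ γ) :=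
    hT.comp_measurable (by fun_prop)
  rw [hfun]
  refine ⟨StronglyMeasurable.aestronglyMeasurable ?_, ?_⟩
  · refine StronglyMeasurable.smul (f := fun t : ℝ => ((γ * t ^ (γ - 1) : ℝ) : ℂ))
      (Measurable.stronglyMeasurable (by fun_prop)) ?_
    refine StronglyMeasurable.integral_prod_right (ν := volume.restrict (Ioi 0))
      (f := fun t s => ((s * W s : ℝ) : ℂ) • semigroup A a (s * t ^ γ)) ?_
    exact StronglyMeasurable.smul (f := fun p : ℝ × ℝ => ((p.2 * W p.2 : ℝ) : ℂ))
      (Measurable.stronglyMeasurable (by fun_prop)) hsm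
  · have hle : ∀ t ∈ Ioi (0 : ℝ), ‖((γ * t ^ (γ - 1) : ℝ) : ℂ) •
        ∫ s in Ioi (0 : ℝ), ((s * W s : ℝ) : ℂ) • semigroup A a (s * t ^ γ)‖ₑ ≤
        ∫⁻ s in Ioi (0 : ℝ), ‖W s‖ₑ *
          (ENNReal.ofReal (s * (γ * t ^ (γ - 1))) * ‖semigroup A a (s * t ^ γ)‖ₑ) := by
      intro t ht
      have ht0 : (0 : ℝ) < t := ht
      rw [enorm_smul]
      refine (mul_le_mul_right (enorm_integral_le_lintegral_enorm _) _).trans_eq ?_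
      rw [← lintegral_const_mul' _ _ enorm_ne_top]
      refine setLIntegral_congr_fun measurableSet_Ioi fun s hs => ?_
      have hs0 : (0 : ℝ) < s := hs
      rw [enorm_smul, ← ofReal_norm (E := ℂ), ← ofReal_norm (E := ℂ),
        Complex.norm_real, Complex.norm_real, norm_mul s, ENNReal.ofReal_mul (norm_nonneg _),
        ofReal_norm (E := ℝ) (W s), Real.norm_of_nonneg (by positivity),
        Real.norm_of_nonneg hs0.le, ENNReal.ofReal_mul hs0.le]
      ring
    refine (setLIntegral_mono' measurableSet_Ioi hle).trans_lt ?_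
    rw [lintegral_lintegral_swap]
    · calc _ ≤ ∫⁻ s in Ioi (0 : ℝ), ‖W s‖ₑ * ∫⁻ τ in Ioi (0 : ℝ), ‖semigroup A a τ‖ₑ := by
            refine setLIntegral_mono' measurableSet_Ioi fun s hs => ?_
            rw [lintegral_const_mul' _ _ enorm_ne_top]
            refine mul_le_mul_right ?_ _
            exact lintegral_comp_mul_rpow_le hγ0 hs fun τ => ‖semigroup A a τ‖ₑ
        _ < ∞ := by
            rw [lintegral_mul_const' _ _ hP.lintegral_semigroup_lt_top.ne]
            exact ENNReal.mul_lt_top hWi.2 hP.lintegral_semigroup_lt_top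
    · have h1 := hsm.enorm
      exact Measurable.aemeasurable (by fun_prop)

end

/-! ### Convolution with an integrable operator kernel, and Stepanov estimates. -/

section

variable {E : Type*} [NormedAddCommGroup E] [NormedSpace ℂ E]

/-! ### Convolution of an integrable operator kernel with bounded functions -/

/-- The convolution `∫ k(t - s) g(s) ds`. -/
def opConv (k : ℝ → E →L[ℂ] E) (g : ℝ → E) (t : ℝ) : E :=
  ∫ s, k (t - s) (g s)

theorem enorm_opConv_le (k : ℝ → E →L[ℂ] E) (g : ℝ → E) (t : ℝ) :
    ‖opConv k g t‖ₑ ≤ ∫⁻ s, ‖k (t - s)‖ₑ * ‖g s‖ₑ :=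
  (enorm_integral_le_lintegral_enorm _).trans
    (lintegral_mono fun s => (k (t - s)).le_opENorm (g s))

theorem aestronglyMeasurable_apply {μ : Measure ℝ} {k : ℝ → E →L[ℂ] E} {g : ℝ → E}
    (hk : AEStronglyMeasurable k μ) (hg : AEStronglyMeasurable g μ) :
    AEStronglyMeasurable (fun s => k s (g s)) μ :=
  (isBoundedBilinearMap_apply (𝕜 := ℂ) (E := E) (F := E)).continuous.comp_aestronglyMeasurable
    (hk.prodMk hg)

theorem integrable_kernel_apply {k : ℝ → E →L[ℂ] E} (hk : Integrable k) {g : ℝ → E}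
    (hg : AEStronglyMeasurable g) {C : ℝ} (hC : ∀ s, ‖g s‖ ≤ C) (t : ℝ) :
    Integrable fun s => k (t - s) (g s) := by
  have hk' := hk.comp_sub_left t
  refine Integrable.mono' (hk'.norm.mul_const C) (aestronglyMeasurable_apply hk'.1 hg)
    (Eventually.of_forall fun s => ?_)
  exact ((k (t - s)).le_opNorm _).trans (mul_le_mul_of_nonneg_left (hC s) (norm_nonneg _))

theorem opConv_sub {k : ℝ → E →L[ℂ] E} (hk : Integrable k) {f g : ℝ → E}
    (hf : AEStronglyMeasurable f) (hg : AEStronglyMeasurable g) {C : ℝ}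
    (hfC : ∀ s, ‖f s‖ ≤ C) (hgC : ∀ s, ‖g s‖ ≤ C) (t : ℝ) :
    opConv k f t - opConv k g t = opConv k (fun s => f s - g s) t := by
  simp only [opConv, map_sub]
  rw [integral_sub (integrable_kernel_apply hk hf hfC t) (integrable_kernel_apply hk hg hgC t)]

theorem norm_opConv_le {k : ℝ → E →L[ℂ] E} (hk : Integrable k) {g : ℝ → E} {C : ℝ}
    (hC : ∀ s, ‖g s‖ ≤ C) (t : ℝ) : ‖opConv k g t‖ ≤ (∫ s, ‖k s‖) * C := by
  rw [← integral_sub_left_eq_self (fun s => ‖k s‖) volume t, ← integral_mul_const]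
  refine norm_integral_le_of_norm_le ((hk.comp_sub_left t).norm.mul_const C)
    (Eventually.of_forall fun s => ?_)
  exact ((k (t - s)).le_opNorm _).trans (mul_le_mul_of_nonneg_left (hC s) (norm_nonneg _))

theorem tendsto_lintegral_translate_sub {G : Type*} [NormedAddCommGroup G] {k : ℝ → G}
    (hk : Integrable k) :
    Tendsto (fun h : ℝ => ∫⁻ s, ‖k (h + s) - k s‖ₑ) (𝓝 0) (𝓝 0) := by
  have hL : MemLp k 1 volume := memLp_one_iff_integrable.2 hk
  have : Fact ((1 : ℝ≥0∞) ≠ ∞) := ⟨ENNReal.one_ne_top⟩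
  have hc : Continuous fun h : ℝ => (DomAddAct.mk h) +ᵥ hL.toLp k :=
    (DomAddAct.continuous_mk).vadd continuous_const
  have h0 : Tendsto (fun h : ℝ => edist ((DomAddAct.mk h) +ᵥ hL.toLp k) (hL.toLp k)) (𝓝 0)
      (𝓝 0) := by
    have h1 : Continuous fun h : ℝ => edist ((DomAddAct.mk h) +ᵥ hL.toLp k) (hL.toLp k) :=
      hc.edist continuous_const
    refine h1.tendsto' 0 0 ?_
    rw [DomAddAct.mk_zero, zero_vadd, edist_self]
  refine h0.congr fun h => ?_
  rw [DomAddAct.mk_vadd_toLp, Lp.edist_toLp_toLp, eLpNorm_one_eq_lintegral_enorm]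
  rfl

/-- The modulus of continuity is the `L¹` modulus of translation of `k`, times the bound on `g`. -/
theorem uniformContinuous_opConv {k : ℝ → E →L[ℂ] E} (hk : Integrable k) {g : ℝ → E}
    (hg : AEStronglyMeasurable g) {C : ℝ} (hC : ∀ s, ‖g s‖ ≤ C) :
    UniformContinuous (opConv k g) := by
  have hle : ∀ x y : ℝ, edist (opConv k g x) (opConv k g y) ≤
      (∫⁻ s, ‖k (x - y + s) - k s‖ₑ) * ENNReal.ofReal C := by
    intro x y
    have h1 : opConv k g x - opConv k g y = ∫ s, (k (x - s) - k (y - s)) (g s) := by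
      rw [opConv, opConv, ← integral_sub (integrable_kernel_apply hk hg hC x)
        (integrable_kernel_apply hk hg hC y)]
      rfl
    rw [edist_eq_enorm_sub, h1, ← lintegral_sub_left_eq_self _ y,
      ← lintegral_mul_const' _ _ ENNReal.ofReal_ne_top]
    refine (enorm_integral_le_lintegral_enorm _).trans (lintegral_mono fun s => ?_)
    refine ((k (x - s) - k (y - s)).le_opENorm (g s)).trans ?_
    rw [show x - y + (y - s) = x - s by ring]
    gcongr
    rw [← ofReal_norm]
    exact ENNReal.ofReal_le_ofReal (hC s)
  have ht : Tendsto (fun h : ℝ => (∫⁻ s, ‖k (h + s) - k s‖ₑ) * ENNReal.ofReal C) (𝓝 0) (𝓝 0) := by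
    simpa using ENNReal.Tendsto.mul_const (tendsto_lintegral_translate_sub hk)
      (Or.inr ENNReal.ofReal_ne_top)
  rw [EMetric.uniformContinuous_iff]
  intro ε hε
  obtain ⟨δ, hδ, hδε⟩ := EMetric.mem_nhds_iff.1 (ht.eventually_lt_const hε)
  refine ⟨δ, hδ, fun {x y} hxy => (hle x y).trans_lt (hδε ?_)⟩
  simpa [edist_eq_enorm_sub] using hxy

theorem setLIntegral_Icc_add_nat_le {g : ℝ → ℝ≥0∞} {δ : ℝ≥0∞}
    (hg : ∀ t : ℝ, ∫⁻ s in Icc t (t + 1), g s ≤ δ) (x : ℝ) (n : ℕ) :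
    ∫⁻ s in Icc x (x + n), g s ≤ n * δ := by
  induction n with
  | zero => simp
  | succ n ih =>
    have hsub : Icc x (x + (n + 1 : ℕ)) ⊆ Icc x (x + n) ∪ Icc (x + n) (x + n + 1) := by
      intro s hs
      rcases le_total s (x + n) with h | h
      · exact Or.inl ⟨hs.1, h⟩
      · refine Or.inr ⟨h, ?_⟩
        have := hs.2
        push_cast at this
        linarith
    refine (lintegral_mono_set hsub).trans ((lintegral_union_le _ _ _).trans ?_)
    push_cast
    rw [add_mul, one_mul]
    exact add_le_add ih (hg _)

/-- Convolution with an integrable kernel is small on bounded functions which are small in the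
Stepanov norm. -/
theorem exists_lintegral_kernel_mul_le {k : ℝ → E →L[ℂ] E} (hk : Integrable k) (C : ℝ)
    {ε : ℝ≥0∞} (hε : ε ≠ 0) :
    ∃ δ : ℝ≥0∞, δ ≠ 0 ∧ ∀ g : ℝ → E, (∀ s, ‖g s‖ ≤ C) →
      (∀ t : ℝ, ∫⁻ s in Icc t (t + 1), ‖g s‖ₑ ≤ δ) →
      ∀ t : ℝ, ∫⁻ s, ‖k (t - s)‖ₑ * ‖g s‖ₑ ≤ ε := by
  have hε2 : ε / 2 ≠ 0 := by simpa using hε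
  obtain ⟨η, hη0, hη⟩ := ENNReal.exists_nnreal_pos_mul_lt (ENNReal.ofReal_ne_top (r := C)) hε2
  -- Split `k` into a compactly supported continuous `φ` and an `L¹`-small rest. The rest is paired
  -- with the bound `C`; `φ`, bounded by `N` and supported in `[-m, m]`, meets only `2m` unit
  -- intervals, where the Stepanov bound acts.
  obtain ⟨φ, hφs, hφ, hφc, -⟩ := hk.exists_hasCompactSupport_lintegral_sub_le
    (ε := (η : ℝ≥0∞)) (by simpa using hη0.ne')
  obtain ⟨N, hN⟩ := hφs.exists_bound_of_continuous hφc
  obtain ⟨ρ, hρ⟩ := hφs.isCompact.isBounded.subset_closedBall (0 : ℝ)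
  obtain ⟨m, hm⟩ := exists_nat_ge ρ
  obtain ⟨δ, hδ0, hδ⟩ := ENNReal.exists_nnreal_pos_mul_lt
    (a := ENNReal.ofReal N * (2 * m : ℕ)) (ENNReal.mul_ne_top ENNReal.ofReal_ne_top (ENNReal.natCast_ne_top _)) hε2
  refine ⟨δ, by simpa using hδ0.ne', fun g hgC hg t => ?_⟩
  have hpt : ∀ s, ‖k (t - s)‖ₑ * ‖g s‖ₑ ≤ ‖k (t - s) - φ (t - s)‖ₑ * ENNReal.ofReal C +
      ENNReal.ofReal N * (Icc (t - m) (t - m + (2 * m : ℕ))).indicator (fun s => ‖g s‖ₑ) s := by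
    intro s
    have h1 : ‖k (t - s)‖ₑ ≤ ‖k (t - s) - φ (t - s)‖ₑ + ‖φ (t - s)‖ₑ := by
      simpa using enorm_add_le (k (t - s) - φ (t - s)) (φ (t - s))
    have h2 : ‖g s‖ₑ ≤ ENNReal.ofReal C := by
      rw [← ofReal_norm]
      exact ENNReal.ofReal_le_ofReal (hgC s)
    refine (mul_le_mul_left h1 _).trans ?_
    rw [add_mul]
    refine add_le_add (mul_le_mul_right h2 _) ?_
    by_cases hs : s ∈ Icc (t - m) (t - m + (2 * m : ℕ))
    · rw [indicator_of_mem hs]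
      gcongr
      rw [← ofReal_norm]
      exact ENNReal.ofReal_le_ofReal (hN _)
    · have : φ (t - s) = 0 := by
        by_contra h0
        have := hρ (subset_tsupport _ h0)
        rw [mem_closedBall_zero_iff, Real.norm_eq_abs, abs_le] at this
        refine hs ⟨by linarith, ?_⟩
        push_cast
        linarith
      have h0 : ‖φ (t - s)‖ₑ = 0 := by
        rw [← ofReal_norm, this, norm_zero, ENNReal.ofReal_zero]
      rw [h0, zero_mul]
      exact zero_le
  have hmeas : AEMeasurable fun s => ‖k (t - s) - φ (t - s)‖ₑ * ENNReal.ofReal C :=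
    (((hk.comp_sub_left t).1.sub (hφc.comp (continuous_const.sub
      continuous_id)).aestronglyMeasurable).enorm).mul_const _
  calc ∫⁻ s, ‖k (t - s)‖ₑ * ‖g s‖ₑ ≤ _ := lintegral_mono hpt
    _ = (∫⁻ s, ‖k s - φ s‖ₑ) * ENNReal.ofReal C + ENNReal.ofReal N *
        ∫⁻ s in Icc (t - m) (t - m + (2 * m : ℕ)), ‖g s‖ₑ := by
      rw [lintegral_add_left' hmeas, lintegral_mul_const' _ _ ENNReal.ofReal_ne_top,
        lintegral_const_mul' _ _ ENNReal.ofReal_ne_top, lintegral_indicator measurableSet_Icc,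
        lintegral_sub_left_eq_self (fun s => ‖k s - φ s‖ₑ) t]
    _ ≤ η * ENNReal.ofReal C + ENNReal.ofReal N * ((2 * m : ℕ) * δ) := by
      gcongr
      exact setLIntegral_Icc_add_nat_le hg _ _
    _ ≤ ε / 2 + ε / 2 := by
      refine add_le_add hη.le (le_of_eq_of_le ?_ hδ.le)
      ring
    _ = ε := ENNReal.add_halves ε

/-! ### Measurability and Stepanov norms -/

theorem MemLpLoc.aestronglyMeasurable {G : Type*} [NormedAddCommGroup G] {p : ℝ} {f : ℝ → G}
    (hf : MemLpLoc p f) : AEStronglyMeasurable f volume := by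
  have h : (⋃ n : ℕ, Icc (-(n : ℝ)) n) = univ := by
    refine eq_univ_of_forall fun x => mem_iUnion.2 ?_
    obtain ⟨n, hn⟩ := exists_nat_ge |x|
    exact ⟨n, abs_le.1 hn⟩
  rw [← Measure.restrict_univ (μ := (volume : Measure ℝ)), ← h]
  exact AEStronglyMeasurable.iUnion fun n => (hf _ _).1

theorem lintegral_Icc_le_rpow {p : ℝ} (hp : 1 < p) {h : ℝ → ℝ≥0∞} (hh : AEMeasurable h) (t : ℝ) :
    ∫⁻ s in Icc t (t + 1), h s ≤ (∫⁻ s in Icc t (t + 1), h s ^ p) ^ (1 / p) := by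
  have := ENNReal.lintegral_mul_le_Lp_mul_Lq (volume.restrict (Icc t (t + 1)))
    (Real.HolderConjugate.conjExponent hp) hh.restrict (aemeasurable_const (b := (1 : ℝ≥0∞)))
  simpa using this

theorem setLIntegral_Icc_comp_add (h : ℝ → ℝ≥0∞) (t b : ℝ) :
    ∫⁻ s in Icc t (t + 1), h (s + b) = ∫⁻ s in Icc (t + b) (t + b + 1), h s := by
  rw [← lintegral_indicator measurableSet_Icc, ← lintegral_indicator measurableSet_Icc,
    ← lintegral_add_right_eq_self ((Icc (t + b) (t + b + 1)).indicator h) b]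
  congr 1
  ext s
  have : s ∈ Icc t (t + 1) ↔ s + b ∈ Icc (t + b) (t + b + 1) := by
    simp only [mem_Icc]
    constructor <;> rintro ⟨h1, h2⟩ <;> constructor <;> linarith
  by_cases hs : s ∈ Icc t (t + 1)
  · rw [indicator_of_mem hs, indicator_of_mem (this.1 hs)]
  · rw [indicator_of_notMem hs, indicator_of_notMem (mt this.2 hs)]

theorem MemStepanov.exists_lintegral_le {G : Type*} [NormedAddCommGroup G] {r : ℝ} (hr : 1 < r)
    {f : ℝ → G} (hf : MemStepanov r f) :
    ∃ C : ℝ≥0∞, C ≠ ∞ ∧ ∀ t : ℝ, ∫⁻ s in Icc t (t + 1), ‖f s‖ₑ ≤ C :=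
  ⟨_, hf.2.ne, fun t => (lintegral_Icc_le_rpow hr hf.1.aestronglyMeasurable.enorm t).trans
    (le_iSup (fun t : ℝ => (∫⁻ s in Icc t (t + 1), ‖f s‖ₑ ^ r) ^ (1 / r)) t)⟩

/-- Carathéodory functions composed with continuous functions are measurable. -/
theorem aestronglyMeasurable_superposition {E : Type*} [NormedAddCommGroup E] {F : ℝ → E → E}
    (hF : ∀ x, AEStronglyMeasurable (fun s => F s x) volume) (hFc : ∀ s, Continuous (F s))
    {f : ℝ → E} (hf : Continuous f) : AEStronglyMeasurable (fun s => F s (f s)) volume := by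
  -- Sample `f` at the grid point just left of `s`: on each grid cell the space argument is
  -- constant, and continuity of `F s` gives the pointwise limit.
  refine aestronglyMeasurable_of_tendsto_ae atTop
    (f := fun (n : ℕ) s => F s (f (⌊((n : ℝ) + 1) * s⌋ / ((n : ℝ) + 1)))) (fun n => ?_)
    (Eventually.of_forall fun s => ?_)
  · have h : (⋃ j : ℤ, (fun s : ℝ => ⌊((n : ℝ) + 1) * s⌋) ⁻¹' {j}) = univ :=
      eq_univ_of_forall fun x => mem_iUnion.2 ⟨_, rfl⟩
    rw [← Measure.restrict_univ (μ := (volume : Measure ℝ)), ← h]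
    refine AEStronglyMeasurable.iUnion fun j => ?_
    have hm : MeasurableSet ((fun s : ℝ => ⌊((n : ℝ) + 1) * s⌋) ⁻¹' {j}) :=
      (Int.measurable_floor.comp (measurable_const.mul measurable_id)) (measurableSet_singleton j)
    refine ((hF (f (j / ((n : ℝ) + 1)))).restrict).congr ?_
    filter_upwards [ae_restrict_mem hm] with s hs
    have hs : ⌊((n : ℝ) + 1) * s⌋ = j := hs
    rw [hs]
  · refine ((hFc s).tendsto _).comp ((hf.tendsto _).comp ?_)
    refine tendsto_of_tendsto_of_tendsto_of_le_of_le (g := fun n : ℕ => s - 1 / ((n : ℝ) + 1))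
      (h := fun _ => s) ?_ tendsto_const_nhds (fun n => ?_) (fun n => ?_)
    · simpa using (tendsto_one_div_add_atTop_nhds_zero_nat (𝕜 := ℝ)).const_sub s
    · have hn : (0 : ℝ) < (n : ℝ) + 1 := by positivity
      have := Int.lt_floor_add_one (((n : ℝ) + 1) * s)
      simp only
      rw [le_div_iff₀ hn, sub_mul, one_div, inv_mul_cancel₀ hn.ne']
      linarith
    · have hn : (0 : ℝ) < (n : ℝ) + 1 := by positivity
      have := Int.floor_le (((n : ℝ) + 1) * s)
      simp only
      rw [div_le_iff₀ hn]
      linarith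

end

/-! ### The nonlinear operator, twisted translations, and the contraction estimate. -/

section

variable {E : Type*} [NormedAddCommGroup E]

/-! ### The nonlinear convolution operator -/

/-- Nonlinearities which are measurable in time, bounded on bounded sets, and Lipschitz in space
with a locally uniformly integrable Lipschitz modulus. -/
structure IsLipschitzNonlinearity (F : ℝ → E → E) (L : ℝ → ℝ) : Prop where
  meas : ∀ x, AEStronglyMeasurable (fun s => F s x) volume
  bdd : ∀ B : Set E, Bornology.IsBounded B → ∃ C : ℝ, ∀ t, ∀ y ∈ B, ‖F t y‖ ≤ C
  lip : ∀ t x y, ‖F t x - F t y‖ ≤ L t * ‖x - y‖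
  meas_modulus : AEStronglyMeasurable L volume
  modulus_le : ∃ C : ℝ≥0∞, C ≠ ∞ ∧ ∀ t : ℝ, ∫⁻ s in Icc t (t + 1), ‖L s‖ₑ ≤ C

namespace IsLipschitzNonlinearity

variable {F : ℝ → E → E} {L : ℝ → ℝ}

theorem continuous (hF : IsLipschitzNonlinearity F L) (t : ℝ) : Continuous (F t) := by
  refine (LipschitzWith.of_dist_le_mul (K := Real.toNNReal (L t)) fun x y => ?_).continuous
  rw [dist_eq_norm, dist_eq_norm]
  refine (hF.lip t x y).trans (mul_le_mul_of_nonneg_right ?_ (norm_nonneg _))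
  exact Real.le_coe_toNNReal _

theorem enorm_sub_le (hF : IsLipschitzNonlinearity F L) (t : ℝ) (x y : E) :
    ‖F t x - F t y‖ₑ ≤ ENNReal.ofReal (L t) * ‖x - y‖ₑ := by
  rw [← ofReal_norm, ← ofReal_norm, ← ENNReal.ofReal_mul' (norm_nonneg _)]
  exact ENNReal.ofReal_le_ofReal (hF.lip t x y)

theorem enorm_sub_le' (hF : IsLipschitzNonlinearity F L) (t : ℝ) (x y : E) :
    ‖F t x - F t y‖ₑ ≤ ‖L t‖ₑ * ‖x - y‖ₑ :=
  (hF.enorm_sub_le t x y).trans (mul_le_mul_left (Real.ofReal_le_enorm _) _)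

theorem aestronglyMeasurable_comp (hF : IsLipschitzNonlinearity F L) {f : ℝ → E}
    (hf : Continuous f) : AEStronglyMeasurable (fun s => F s (f s)) volume :=
  aestronglyMeasurable_superposition hF.meas hF.continuous hf

theorem exists_bound_comp (hF : IsLipschitzNonlinearity F L) (R : ℝ) :
    ∃ C : ℝ, ∀ f : ℝ → E, (∀ s, ‖f s‖ ≤ R) → ∀ s, ‖F s (f s)‖ ≤ C := by
  obtain ⟨C, hC⟩ := hF.bdd _ (Metric.isBounded_closedBall (x := (0 : E)) (r := R))
  exact ⟨C, fun f hf s => hC s _ (mem_closedBall_zero_iff.2 (hf s))⟩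

variable [NormedSpace ℂ E]

theorem exists_convolution (hF : IsLipschitzNonlinearity F L) {k : ℝ → E →L[ℂ] E}
    (hk : Integrable k) (f : ℝ →ᵇ E) :
    ∃ g : ℝ →ᵇ E, UniformContinuous g ∧ ∀ t, g t = opConv k (fun s => F s (f s)) t := by
  obtain ⟨C, hC⟩ := hF.exists_bound_comp ‖f‖
  have hC' := hC f f.norm_coe_le_norm
  have huc := uniformContinuous_opConv hk (hF.aestronglyMeasurable_comp f.continuous) hC'
  exact ⟨BoundedContinuousFunction.ofNormedAddCommGroup _ huc.continuous _
    (norm_opConv_le hk hC'), huc, fun t => rfl⟩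

/-- Continuity of `Φ`, uniform on balls. No bound on `‖k‖ * |L|` is needed: `F(·, f) - F(·, g)` is
bounded and has Stepanov norm at most a constant times `dist f g`. -/
theorem exists_dist_convolution_le (hF : IsLipschitzNonlinearity F L) {k : ℝ → E →L[ℂ] E}
    (hk : Integrable k) {Φ : (ℝ →ᵇ E) → (ℝ →ᵇ E)}
    (hΦ : ∀ f t, Φ f t = opConv k (fun s => F s (f s)) t) (R : ℝ) {ε : ℝ} (hε : 0 < ε) :
    ∃ δ > 0, ∀ f g : ℝ →ᵇ E, ‖f‖ ≤ R → dist f g ≤ δ → dist (Φ f) (Φ g) ≤ ε := by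
  obtain ⟨C, hC⟩ := hF.exists_bound_comp (R + 1)
  obtain ⟨δ, hδ0, hδ⟩ := exists_lintegral_kernel_mul_le hk (C + C)
    (ENNReal.ofReal_pos.2 hε).ne'
  obtain ⟨D, hD, hLD⟩ := hF.modulus_le
  obtain ⟨η, hη0, hη⟩ := ENNReal.exists_nnreal_pos_mul_lt hD hδ0
  -- The `1` keeps `g` in the ball of radius `R + 1`; `η` makes the Stepanov norm small.
  refine ⟨min 1 η, by positivity, fun f g hf hfg => ?_⟩
  have hg : ‖g‖ ≤ R + 1 := by
    have := norm_le_norm_add_norm_sub f g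
    rw [dist_eq_norm] at hfg
    linarith [hfg.trans (min_le_left _ _)]
  have hfb := hC f fun s => (f.norm_coe_le_norm s).trans (by linarith)
  have hgb := hC g fun s => (g.norm_coe_le_norm s).trans hg
  refine (dist_le hε.le).2 fun t => ?_
  rw [dist_eq_norm, hΦ, hΦ, opConv_sub hk (hF.aestronglyMeasurable_comp f.continuous)
    (hF.aestronglyMeasurable_comp g.continuous) hfb hgb]
  rw [← ENNReal.ofReal_le_ofReal_iff hε.le, ofReal_norm]
  refine (enorm_opConv_le _ _ _).trans (hδ _ (fun s => (norm_sub_le _ _).trans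
    (add_le_add (hfb s) (hgb s))) (fun x => ?_) t)
  calc ∫⁻ s in Icc x (x + 1), ‖F s (f s) - F s (g s)‖ₑ
      ≤ ∫⁻ s in Icc x (x + 1), ‖L s‖ₑ * η := by
        refine lintegral_mono fun s => (hF.enorm_sub_le' _ _ _).trans ?_
        gcongr
        rw [← ofReal_norm, ← dist_eq_norm]
        refine ENNReal.ofReal_le_of_le_toReal ?_
        exact (dist_coe_le_dist s).trans (hfg.trans (min_le_right _ _))
    _ ≤ D * η := by
        rw [lintegral_mul_const' _ _ ENNReal.coe_ne_top]
        gcongr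
        exact hLD x
    _ ≤ δ := by
        rw [mul_comm]
        exact hη.le

/-- A Lipschitz nonlinearity which is Stepanov recurrent along `α` remains so after composition
with bounded uniformly continuous functions. -/
theorem eventually_lintegral_comp_le (hF : IsLipschitzNonlinearity F L) {p : ℝ} (hp : 1 < p)
    {c : ℂ} (hc : ‖c‖ = 1) {α : ℕ → ℝ}
    (hα : ∀ B : Set E, Bornology.IsBounded B → StepanovRecurrentAlong α p c F B)
    {f : ℝ → E} (hf : UniformContinuous f) (hfb : Bornology.IsBounded (range f))
    {δ : ℝ≥0∞} (hδ : δ ≠ 0) :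
    ∀ᶠ j in atTop, ∀ t : ℝ,
      ∫⁻ s in Icc t (t + 1), ‖F (s + α j) (c • f s) - c • F s (f s)‖ₑ ≤ δ := by
  have hδ2 : δ / 2 ≠ 0 := by simpa using hδ
  obtain ⟨D, hD, hLD⟩ := hF.modulus_le
  -- The supremum over `x` stands outside the integral, so `x = f s` cannot be inserted directly.
  -- Instead `f` is frozen at grid points of mesh `1/(m+1)`: `ε` bounds the oscillation, paid for by
  -- the two Lipschitz moduli, and `θ` bounds each of the `m + 2` frozen terms.
  obtain ⟨ε, hε0, hε⟩ := ENNReal.exists_nnreal_pos_mul_lt (ENNReal.add_ne_top.2 ⟨hD, hD⟩) hδ2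
  obtain ⟨η, hη0, hη⟩ := Metric.uniformContinuous_iff.1 hf ε hε0
  obtain ⟨m, hm⟩ := exists_nat_one_div_lt hη0
  obtain ⟨θ, hθ0, hθ⟩ := ENNReal.exists_nnreal_pos_mul_lt
    (ENNReal.natCast_ne_top (m + 2)) hδ2
  have hθp : ((θ : ℝ≥0∞) ^ p) ≠ 0 := by
    rw [Ne, ENNReal.rpow_eq_zero_iff_of_pos (by linarith)]
    simpa using hθ0.ne'
  have hmeas : ∀ j x, AEStronglyMeasurable (fun s => F (s + α j) (c • x) - c • F s x) volume :=
    fun j x => ((hF.meas _).comp_measurePreserving (measurePreserving_add_right volume (α j))).sub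
      ((hF.meas x).const_smul c)
  filter_upwards [(hα _ hfb).eventually_le_const (pos_iff_ne_zero.2 hθp)] with j hj t
  have hsmall : ∀ x ∈ range f,
      ∫⁻ s in Icc t (t + 1), ‖F (s + α j) (c • x) - c • F s x‖ₑ ≤ θ := by
    intro x hx
    refine (lintegral_Icc_le_rpow hp (hmeas j x).enorm t).trans ?_
    rw [one_div, ENNReal.rpow_inv_le_iff (by linarith)]
    refine le_trans ?_ hj
    exact le_iSup_of_le t (le_iSup₂ (f := fun x (_ : x ∈ range f) =>
      ∫⁻ s in Icc t (t + 1), ‖F (s + α j) (c • x) - c • F s x‖ₑ ^ p) x hx)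
  -- Summing over all grid points removes the dependence of the chosen one on `s`. The endpoint `s =
  -- t + 1` gives index `m + 1`, hence `m + 2` terms.
  have hpt : ∀ s ∈ Icc t (t + 1), ‖F (s + α j) (c • f s) - c • F s (f s)‖ₑ ≤
      (∑ i ∈ Finset.range (m + 2), ‖F (s + α j) (c • f (t + i / ((m : ℝ) + 1))) -
        c • F s (f (t + i / ((m : ℝ) + 1)))‖ₑ) + (‖L (s + α j)‖ₑ + ‖L s‖ₑ) * ε := by
    intro s hs
    have hm1 : (0 : ℝ) < (m : ℝ) + 1 := by positivity
    set i := ⌊((m : ℝ) + 1) * (s - t)⌋₊ with hi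
    have hi0 : 0 ≤ ((m : ℝ) + 1) * (s - t) := mul_nonneg hm1.le (by linarith [hs.1])
    have hi1 : (i : ℝ) ≤ ((m : ℝ) + 1) * (s - t) := Nat.floor_le hi0
    have hi2 : ((m : ℝ) + 1) * (s - t) < i + 1 := Nat.lt_floor_add_one _
    have him : i ∈ Finset.range (m + 2) := by
      have : (i : ℝ) ≤ ((m + 1 : ℕ) : ℝ) := by
        push_cast
        refine hi1.trans (mul_le_of_le_one_right hm1.le (by linarith [hs.2]))
      have : i ≤ m + 1 := by exact_mod_cast this
      exact Finset.mem_range.2 (by omega)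
    set x := f (t + i / ((m : ℝ) + 1)) with hx
    have hdist : ‖f s - x‖ₑ ≤ ε := by
      rw [← ofReal_norm, ← dist_eq_norm]
      refine ENNReal.ofReal_le_of_le_toReal (le_of_lt (hη ?_))
      rw [Real.dist_eq]
      refine lt_of_le_of_lt ?_ hm
      have e1 : s - (t + i / ((m : ℝ) + 1)) = (((m : ℝ) + 1) * (s - t) - i) / ((m : ℝ) + 1) := by
        field_simp
        ring
      rw [e1, abs_div, abs_of_pos hm1]
      gcongr
      rw [abs_le]
      constructor <;> linarith
    have hdec : F (s + α j) (c • f s) - c • F s (f s) = (F (s + α j) (c • x) - c • F s x) +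
        ((F (s + α j) (c • f s) - F (s + α j) (c • x)) - c • (F s (f s) - F s x)) := by
      module
    have hce : ‖c‖ₑ = 1 := by rw [← ofReal_norm, hc, ENNReal.ofReal_one]
    rw [hdec]
    refine (enorm_add_le _ _).trans (add_le_add ?_ ?_)
    · exact Finset.single_le_sum (f := fun i : ℕ => ‖F (s + α j) (c • f (t + i / ((m : ℝ) + 1))) -
        c • F s (f (t + i / ((m : ℝ) + 1)))‖ₑ) (fun _ _ => zero_le) him
    · refine (_root_.enorm_sub_le (E := E)).trans ?_
      rw [add_mul, enorm_smul, hce, one_mul]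
      refine add_le_add ((hF.enorm_sub_le' _ _ _).trans ?_) ((hF.enorm_sub_le' _ _ _).trans ?_)
      · rw [← smul_sub, enorm_smul, hce, one_mul]
        gcongr
      · gcongr
  have hLm : AEMeasurable (fun s => (‖L (s + α j)‖ₑ + ‖L s‖ₑ) * (ε : ℝ≥0∞))
      (volume.restrict (Icc t (t + 1))) :=
    (((hF.meas_modulus.comp_measurePreserving (measurePreserving_add_right volume (α j))).enorm.add
      hF.meas_modulus.enorm).mul_const _).restrict
  calc ∫⁻ s in Icc t (t + 1), ‖F (s + α j) (c • f s) - c • F s (f s)‖ₑ ≤ _ :=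
        setLIntegral_mono' measurableSet_Icc hpt
    _ = (∑ i ∈ Finset.range (m + 2), ∫⁻ s in Icc t (t + 1),
          ‖F (s + α j) (c • f (t + i / ((m : ℝ) + 1))) -
            c • F s (f (t + i / ((m : ℝ) + 1)))‖ₑ) +
        ((∫⁻ s in Icc (t + α j) (t + α j + 1), ‖L s‖ₑ) + ∫⁻ s in Icc t (t + 1), ‖L s‖ₑ) * ε := by
      rw [lintegral_add_right' _ hLm, lintegral_finsetSum' _ fun i _ => (hmeas j _).enorm.restrict,
        lintegral_mul_const' _ _ ENNReal.coe_ne_top,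
        lintegral_add_right' _ hF.meas_modulus.enorm.restrict,
        setLIntegral_Icc_comp_add (fun s => ‖L s‖ₑ)]
    _ ≤ (∑ i ∈ Finset.range (m + 2), (θ : ℝ≥0∞)) + (D + D) * ε := by
      gcongr with i
      · exact hsmall _ (mem_range_self _)
      · exact hLD _
      · exact hLD _
    _ ≤ δ / 2 + δ / 2 := by
      refine add_le_add ?_ ?_
      · rw [Finset.sum_const, Finset.card_range, nsmul_eq_mul, mul_comm]
        exact hθ.le
      · rw [mul_comm]
        exact hε.le
    _ = δ := ENNReal.add_halves δ

end IsLipschitzNonlinearity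

variable [NormedSpace ℂ E]

/-- The twisted translation `f ↦ c f(· - b)`. -/
def twistedShift (c : ℂ) (b : ℝ) (f : ℝ →ᵇ E) : ℝ →ᵇ E :=
  c • f.compContinuous ⟨fun t => t - b, by fun_prop⟩

@[simp]
theorem twistedShift_apply (c : ℂ) (b : ℝ) (f : ℝ →ᵇ E) (t : ℝ) :
    twistedShift c b f t = c • f (t - b) := rfl

theorem dist_twistedShift_le {c : ℂ} (hc : ‖c‖ = 1) (b : ℝ) (f g : ℝ →ᵇ E) :
    dist (twistedShift c b f) (twistedShift c b g) ≤ dist f g := by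
  refine (dist_le dist_nonneg).2 fun t => ?_
  rw [twistedShift_apply, twistedShift_apply, dist_smul₀, hc, one_mul]
  exact dist_coe_le_dist _

theorem norm_twistedShift_le {c : ℂ} (hc : ‖c‖ = 1) (b : ℝ) (f : ℝ →ᵇ E) :
    ‖twistedShift c b f‖ ≤ ‖f‖ := by
  refine (norm_le (norm_nonneg _)).2 fun t => ?_
  rw [twistedShift_apply, norm_smul, hc, one_mul]
  exact f.norm_coe_le_norm _

namespace IsLipschitzNonlinearity

variable {F : ℝ → E → E} {L : ℝ → ℝ}

/-- After the change of variable `s ↦ s + α_j`, the two functions differ by the convolution of `k`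
with `F(s + α_j, c f(s)) - c F(s, f(s))`, which is bounded and Stepanov-small. -/
theorem tendsto_dist_twistedShift_convolution (hF : IsLipschitzNonlinearity F L) {p : ℝ}
    (hp : 1 < p) {c : ℂ} (hc : ‖c‖ = 1) {α : ℕ → ℝ}
    (hα : ∀ B : Set E, Bornology.IsBounded B → StepanovRecurrentAlong α p c F B)
    {k : ℝ → E →L[ℂ] E} (hk : Integrable k) {Φ : (ℝ →ᵇ E) → (ℝ →ᵇ E)}
    (hΦ : ∀ f t, Φ f t = opConv k (fun s => F s (f s)) t) {f : ℝ →ᵇ E}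
    (hf : UniformContinuous f) :
    Tendsto (fun j => dist (twistedShift c (α j) (Φ f)) (Φ (twistedShift c (α j) f))) atTop
      (𝓝 0) := by
  rw [Metric.tendsto_atTop']
  intro ε hε
  obtain ⟨C, hC⟩ := hF.exists_bound_comp ‖f‖
  obtain ⟨δ, hδ0, hδ⟩ := exists_lintegral_kernel_mul_le hk (C + C)
    (ENNReal.ofReal_pos.2 (half_pos hε)).ne'
  obtain ⟨N, hN⟩ := eventually_atTop.1
    (hF.eventually_lintegral_comp_le hp hc hα hf f.isBounded_range hδ0)
  refine ⟨N, fun j hj => ?_⟩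
  rw [Real.dist_0_eq_abs, abs_of_nonneg dist_nonneg]
  refine lt_of_le_of_lt ((dist_le (half_pos hε).le).2 fun t => ?_) (half_lt_self hε)
  set g : ℝ → E := fun s => F s (twistedShift c (α j) f s) with hg
  have hgb : ∀ s, ‖g s‖ ≤ C := hC _ fun s =>
    ((twistedShift c (α j) f).norm_coe_le_norm s).trans (norm_twistedShift_le hc _ _)
  have hgm : AEStronglyMeasurable g volume :=
    hF.aestronglyMeasurable_comp (twistedShift c (α j) f).continuous
  have hshift : Φ (twistedShift c (α j) f) t = opConv k (fun s => g (s + α j)) (t - α j) := by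
    rw [hΦ, opConv, opConv, ← integral_add_right_eq_self _ (α j)]
    refine integral_congr_ae (Eventually.of_forall fun s => ?_)
    show k (t - (s + α j)) (g (s + α j)) = k (t - α j - s) (g (s + α j))
    congr 2
    ring
  have hsmul : twistedShift c (α j) (Φ f) t = opConv k (fun s => c • F s (f s)) (t - α j) := by
    rw [twistedShift_apply, hΦ, opConv, opConv, ← integral_smul]
    simp only [map_smul]
  have hcb : ∀ s, ‖c • F s (f s)‖ ≤ C := fun s => by
    rw [norm_smul, hc, one_mul]
    exact hC f f.norm_coe_le_norm s
  have hgα : ∀ s, g (s + α j) = F (s + α j) (c • f s) := fun s => by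
    simp [hg]
  rw [dist_comm, dist_eq_norm, hshift, hsmul, opConv_sub (f := fun s => g (s + α j))
    (g := fun s => c • F s (f s)) hk
    (hgm.comp_measurePreserving (measurePreserving_add_right volume (α j)))
    ((hF.aestronglyMeasurable_comp f.continuous).const_smul c) (fun s => hgb _) hcb,
    ← ENNReal.ofReal_le_ofReal_iff (half_pos hε).le, ofReal_norm]
  refine (enorm_opConv_le _ _ _).trans (hδ _ (fun s => (norm_sub_le _ _).trans
    (add_le_add (hgb _) (hcb s))) (fun x => ?_) _)
  simp only [hgα]
  exact hN j hj.le x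

/-- Each further step adds one commutation error at `Φ^m f` and the image under `Φ` of the previous
error. The latter is controlled because `twistedShift c (α j) (Φ^[m] f)` stays in one ball for all
`j`. -/
theorem tendsto_dist_twistedShift_iterate (hF : IsLipschitzNonlinearity F L) {p : ℝ}
    (hp : 1 < p) {c : ℂ} (hc : ‖c‖ = 1) {α : ℕ → ℝ}
    (hα : ∀ B : Set E, Bornology.IsBounded B → StepanovRecurrentAlong α p c F B)
    {k : ℝ → E →L[ℂ] E} (hk : Integrable k) {Φ : (ℝ →ᵇ E) → (ℝ →ᵇ E)}
    (hΦ : ∀ f t, Φ f t = opConv k (fun s => F s (f s)) t)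
    (hΦu : ∀ f, UniformContinuous (Φ f)) {f : ℝ →ᵇ E} (hf : UniformContinuous f) (m : ℕ) :
    Tendsto (fun j => dist (twistedShift c (α j) (Φ^[m] f)) (Φ^[m] (twistedShift c (α j) f)))
      atTop (𝓝 0) := by
  induction m with
  | zero => simp
  | succ m ih =>
    have hy : UniformContinuous (Φ^[m] f) := by
      cases m with
      | zero => exact hf
      | succ m =>
        rw [Function.iterate_succ_apply']
        exact hΦu _
    have h1 := hF.tendsto_dist_twistedShift_convolution hp hc hα hk hΦ hy
    have h2 : Tendsto (fun j => dist (Φ (twistedShift c (α j) (Φ^[m] f)))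
        (Φ (Φ^[m] (twistedShift c (α j) f)))) atTop (𝓝 0) := by
      rw [Metric.tendsto_atTop']
      intro ε hε
      obtain ⟨δ, hδ0, hδ⟩ := hF.exists_dist_convolution_le hk hΦ ‖Φ^[m] f‖ (half_pos hε)
      obtain ⟨N, hN⟩ := eventually_atTop.1 (ih.eventually_le_const hδ0)
      refine ⟨N, fun j hj => ?_⟩
      rw [Real.dist_0_eq_abs, abs_of_nonneg dist_nonneg]
      exact (hδ _ _ (norm_twistedShift_le hc _ _) (hN j hj.le)).trans_lt (half_lt_self hε)
    refine squeeze_zero (fun _ => dist_nonneg) (fun j => ?_) (by simpa using h1.add h2)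
    rw [Function.iterate_succ_apply', Function.iterate_succ_apply']
    exact dist_triangle _ _ _

/-- The kernel vanishes for `s ≥ t`, so unrolling the Lipschitz bound reproduces the nested
integrals. The estimate is kept pointwise in `t`, since their supremum is controlled only over `t ≥
0`. -/
theorem enorm_iterate_sub_le (hF : IsLipschitzNonlinearity F L) {R : ℝ → E →L[ℂ] E}
    (hk : Integrable ((Ioi 0).indicator R)) {Φ : (ℝ →ᵇ E) → (ℝ →ᵇ E)}
    (hΦ : ∀ f t, Φ f t = opConv ((Ioi 0).indicator R) (fun s => F s (f s)) t) (f g : ℝ →ᵇ E)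
    (m : ℕ) (t : ℝ) :
    ‖Φ^[m] f t - Φ^[m] g t‖ₑ ≤ iteratedKernel R L m t * edist f g := by
  induction m generalizing t with
  | zero =>
    rw [iteratedKernel, one_mul, edist_dist, ← ofReal_norm, ← dist_eq_norm]
    exact ENNReal.ofReal_le_ofReal (dist_coe_le_dist t)
  | succ m ih =>
    set f' := Φ^[m] f
    set g' := Φ^[m] g
    obtain ⟨C, hC⟩ := hF.exists_bound_comp (max ‖f'‖ ‖g'‖)
    rw [Function.iterate_succ_apply', Function.iterate_succ_apply', hΦ, hΦ,
      opConv_sub hk (hF.aestronglyMeasurable_comp f'.continuous)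
        (hF.aestronglyMeasurable_comp g'.continuous)
        (hC _ fun s => (f'.norm_coe_le_norm s).trans (le_max_left _ _))
        (hC _ fun s => (g'.norm_coe_le_norm s).trans (le_max_right _ _)),
      iteratedKernel, ← lintegral_mul_const' _ _ (edist_ne_top _ _),
      ← lintegral_indicator measurableSet_Iio]
    refine (enorm_opConv_le _ _ _).trans (lintegral_mono fun s => ?_)
    by_cases hs : s ∈ Iio t
    · rw [indicator_of_mem hs, indicator_of_mem (mem_Ioi.2 (sub_pos.2 (mem_Iio.1 hs))),
        mul_assoc, mul_assoc]
      gcongr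
      refine (hF.enorm_sub_le _ _ _).trans ?_
      gcongr
      exact ih s
    · rw [indicator_of_notMem hs,
        indicator_of_notMem (fun h => hs (mem_Iio.2 (sub_pos.1 (mem_Ioi.1 h))))]
      rw [← ofReal_norm, norm_zero, ENNReal.ofReal_zero, zero_mul]

/-- The contraction constant on the half-line controls the sup-norm on the whole line. -/
theorem dist_iterate_le (hF : IsLipschitzNonlinearity F L) {p : ℝ}
    (hp : 1 < p) {c : ℂ} (hc : ‖c‖ = 1) {α : ℕ → ℝ} (hαt : Tendsto α atTop atTop)
    (hα : ∀ B : Set E, Bornology.IsBounded B → StepanovRecurrentAlong α p c F B)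
    {R : ℝ → E →L[ℂ] E} (hk : Integrable ((Ioi 0).indicator R)) {Φ : (ℝ →ᵇ E) → (ℝ →ᵇ E)}
    (hΦ : ∀ f t, Φ f t = opConv ((Ioi 0).indicator R) (fun s => F s (f s)) t)
    (hΦu : ∀ f, UniformContinuous (Φ f)) {m : ℕ} (hM : kernelConst R L m ≠ ∞)
    {f g : ℝ →ᵇ E} (hf : UniformContinuous f) (hg : UniformContinuous g) :
    dist (Φ^[m] f) (Φ^[m] g) ≤ (kernelConst R L m).toReal * dist f g := by
  refine (dist_le (by positivity)).2 fun t => ?_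
  have h1 := hF.tendsto_dist_twistedShift_iterate hp hc hα hk hΦ hΦu hf m
  have h2 := hF.tendsto_dist_twistedShift_iterate hp hc hα hk hΦ hΦu hg m
  have h3 := (h1.add h2).add_const ((kernelConst R L m).toReal * dist f g)
  rw [add_zero, zero_add] at h3
  refine ge_of_tendsto h3 ?_
  -- For such `j` the shifted time `t + α j` is nonnegative, where `kernelConst` applies; the two
  -- commutation errors vanish as `j → ∞`.
  filter_upwards [hαt.eventually_ge_atTop (-t)] with j hj
  have hcontr : dist (Φ^[m] (twistedShift c (α j) f) (t + α j))
      (Φ^[m] (twistedShift c (α j) g) (t + α j)) ≤ (kernelConst R L m).toReal * dist f g := by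
    have h := hF.enorm_iterate_sub_le hk hΦ (twistedShift c (α j) f) (twistedShift c (α j) g) m
      (t + α j)
    have hle : iteratedKernel R L m (t + α j) ≤ kernelConst R L m :=
      le_iSup₂ (f := fun t (_ : t ∈ Ici (0 : ℝ)) => iteratedKernel R L m t) (t + α j)
        (show (0 : ℝ) ≤ t + α j by linarith)
    have h' := h.trans (mul_le_mul' hle (show edist _ _ ≤ edist f g by
      rw [edist_dist, edist_dist]
      exact ENNReal.ofReal_le_ofReal (dist_twistedShift_le hc _ f g)))
    rw [← ofReal_norm, ← dist_eq_norm] at h'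
    have h'' := ENNReal.toReal_mono (ENNReal.mul_ne_top hM (edist_ne_top _ _)) h'
    rwa [ENNReal.toReal_ofReal dist_nonneg, ENNReal.toReal_mul, ← dist_edist] at h''
  have hshift : dist (Φ^[m] f t) (Φ^[m] g t) =
      dist (twistedShift c (α j) (Φ^[m] f) (t + α j)) (twistedShift c (α j) (Φ^[m] g) (t + α j)) := by
    rw [twistedShift_apply, twistedShift_apply, dist_smul₀, hc, one_mul, add_sub_cancel_right]
  rw [hshift]
  have e1 := dist_coe_le_dist (f := twistedShift c (α j) (Φ^[m] f))
    (g := Φ^[m] (twistedShift c (α j) f)) (t + α j)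
  have e2 := dist_coe_le_dist (f := twistedShift c (α j) (Φ^[m] g))
    (g := Φ^[m] (twistedShift c (α j) g)) (t + α j)
  have e3 := dist_triangle4 (twistedShift c (α j) (Φ^[m] f) (t + α j))
    (Φ^[m] (twistedShift c (α j) f) (t + α j)) (Φ^[m] (twistedShift c (α j) g) (t + α j))
    (twistedShift c (α j) (Φ^[m] g) (t + α j))
  rw [dist_comm (Φ^[m] (twistedShift c (α j) g) (t + α j))] at e3
  linarith

end IsLipschitzNonlinearity

end

/-! ### Uniform recurrence, the fixed point, and its link with mild solutions. -/

section

variable {E : Type*} [NormedAddCommGroup E] [NormedSpace ℂ E]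

/-! ### Recurrence -/

/-- By compactness of the circle two distinct powers of `c` are close; divide by the smaller one,
which has modulus one. -/
theorem exists_norm_pow_sub_one_lt {c : ℂ} (hc : ‖c‖ = 1) {ε : ℝ} (hε : 0 < ε) :
    ∃ m : ℕ, 1 ≤ m ∧ ‖c ^ m - 1‖ < ε := by
  obtain ⟨a, -, φ, hφ, ha⟩ := (isCompact_sphere (0 : ℂ) 1).tendsto_subseq
    (x := fun n : ℕ => c ^ n) (fun n => by simp [hc])
  obtain ⟨N, hN⟩ := Metric.cauchySeq_iff.1 ha.cauchySeq ε hε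
  have hlt : φ N < φ (N + 1) := hφ (Nat.lt_succ_self N)
  refine ⟨φ (N + 1) - φ N, by omega, ?_⟩
  have h := hN (N + 1) (Nat.le_succ N) N le_rfl
  have h2 : c ^ φ (N + 1) - c ^ φ N = c ^ φ N * (c ^ (φ (N + 1) - φ N) - 1) := by
    rw [mul_sub, ← pow_add, Nat.add_sub_cancel' hlt.le, mul_one]
  simp only [Function.comp_apply] at h
  rwa [dist_eq_norm, h2, norm_mul, norm_pow, hc, one_pow, one_mul] at h

theorem tendsto_iSup_enorm_of_le {E : Type*} [NormedAddCommGroup E] {ι : Type*} {l : Filter ι} {f : ι → ℝ → E} {b : ι → ℝ}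
    (hfb : ∀ j t, ‖f j t‖ ≤ b j) (hb : Tendsto b l (𝓝 0)) :
    Tendsto (fun j => ⨆ t, ‖f j t‖ₑ) l (𝓝 0) := by
  have h : Tendsto (fun j => ENNReal.ofReal (b j)) l (𝓝 0) := by
    simpa using ENNReal.tendsto_ofReal hb
  refine tendsto_of_tendsto_of_tendsto_of_le_of_le tendsto_const_nhds h (fun _ => zero_le)
    fun j => iSup_le fun t => ?_
  rw [← ofReal_norm]
  exact ENNReal.ofReal_le_ofReal (hfb j t)

theorem RecurrentAlong.eventually_norm_le {α : ℕ → ℝ} {c : ℂ} {f : ℝ → E}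
    (hf : RecurrentAlong α c f) {ε : ℝ} (hε : 0 < ε) :
    ∀ᶠ j in atTop, ∀ t, ‖f (t + α j) - c • f t‖ ≤ ε := by
  filter_upwards [hf.eventually_le_const (ENNReal.ofReal_pos.2 hε)] with j hj t
  have := (le_iSup (fun t => ‖f (t + α j) - c • f t‖ₑ) t).trans hj
  rwa [← ofReal_norm, ENNReal.ofReal_le_ofReal_iff hε.le] at this

theorem norm_translate_mul_sub_le {c : ℂ} (hc : ‖c‖ = 1) {f : ℝ → E} {b η : ℝ}
    (h : ∀ t, ‖f (t + b) - c • f t‖ ≤ η) (m : ℕ) (t : ℝ) :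
    ‖f (t + m * b) - c ^ m • f t‖ ≤ m * η := by
  induction m with
  | zero => simp
  | succ m ih =>
    have e : f (t + (m + 1 : ℕ) * b) - c ^ (m + 1) • f t =
        (f (t + m * b + b) - c • f (t + m * b)) + c • (f (t + m * b) - c ^ m • f t) := by
      rw [show t + (m + 1 : ℕ) * b = t + m * b + b by push_cast; ring]
      module
    rw [e]
    refine (norm_add_le _ _).trans ?_
    rw [norm_smul, hc, one_mul]
    push_cast
    linarith [h (t + m * b)]

/-- Bounded `c`-uniformly recurrent functions are uniformly recurrent if `‖c‖ = 1`. -/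
theorem mem_UR_one_of_mem_BUR {α : ℕ → ℝ} (hα : IsRecurrenceSequence α) {c : ℂ} (hc : ‖c‖ = 1)
    {f : ℝ → E} (hf : f ∈ BUR α c) : f ∈ UR (1 : ℂ) := by
  obtain ⟨⟨hcont, -⟩, hbdd, hrec⟩ := hf
  obtain ⟨K, hK0, hK⟩ := hbdd.exists_pos_norm_le
  have hex : ∀ j : ℕ, ∃ b : ℝ, (j : ℝ) < b ∧ ∀ t, ‖f (t + b) - f t‖ ≤ 1 / ((j : ℝ) + 1) := by
    intro j
    have hε : (0 : ℝ) < 1 / ((j : ℝ) + 1) / 2 := by positivity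
    -- The power `m` is fixed before the shift: the error along `α n` can then be required to be
    -- below `1/m` of the tolerance, so that `m` repetitions still fit.
    obtain ⟨m, hm1, hm⟩ := exists_norm_pow_sub_one_lt hc (div_pos hε hK0)
    have hm0 : (0 : ℝ) < m := by exact_mod_cast hm1
    obtain ⟨n, hn, hnj⟩ := ((hrec.eventually_norm_le (div_pos hε hm0)).and
      (hα.tendsto.eventually_gt_atTop (j : ℝ))).exists
    refine ⟨m * α n, hnj.trans_le (le_mul_of_one_le_left (hα.pos n).le (by exact_mod_cast hm1)),
      fun t => ?_⟩
    have h1 := norm_translate_mul_sub_le hc hn m t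
    rw [mul_div_cancel₀ _ hm0.ne'] at h1
    have h2 : ‖(c ^ m - 1) • f t‖ ≤ 1 / ((j : ℝ) + 1) / 2 := by
      rw [norm_smul]
      calc ‖c ^ m - 1‖ * ‖f t‖ ≤ 1 / ((j : ℝ) + 1) / 2 / K * K :=
            mul_le_mul hm.le (hK _ (mem_range_self t)) (norm_nonneg _) (by positivity)
        _ = _ := div_mul_cancel₀ _ hK0.ne'
    have e : f (t + m * α n) - f t = (f (t + m * α n) - c ^ m • f t) + (c ^ m - 1) • f t := by
      module
    rw [e]
    linarith [norm_add_le (f (t + m * α n) - c ^ m • f t) ((c ^ m - 1) • f t)]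
  choose b hb hbf using hex
  have hbt : Tendsto b atTop atTop :=
    tendsto_atTop_mono (fun j => (hb j).le) tendsto_natCast_atTop_atTop
  obtain ⟨φ, hφ, hbφ⟩ := strictMono_subseq_of_tendsto_atTop hbt
  refine ⟨hcont, b ∘ φ, ⟨hbφ, fun j => lt_of_le_of_lt (Nat.cast_nonneg _) (hb (φ j)),
    hbt.comp hφ.tendsto_atTop⟩, ?_⟩
  refine tendsto_iSup_enorm_of_le (b := fun j => 1 / ((φ j : ℝ) + 1)) (fun j t => ?_)
    ((tendsto_one_div_add_atTop_nhds_zero_nat (𝕜 := ℝ)).comp hφ.tendsto_atTop)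
  rw [one_smul]
  exact hbf (φ j) t

theorem isComplete_uniformContinuous {E : Type*} [NormedAddCommGroup E] [CompleteSpace E] :
    IsComplete {f : ℝ →ᵇ E | UniformContinuous f} := by
  refine IsClosed.isComplete (IsSeqClosed.isClosed fun x f hx hf => ?_)
  exact (tendsto_iff_tendstoUniformly.1 hf).uniformContinuous (Frequently.of_forall hx)

/-- Banach's theorem gives a fixed point of `Φ^n`; `Φ u` is another one, hence equals `u`. Fixed
points lie in the range of `Φ^n`, so they are uniformly continuous and uniqueness holds among all
bounded continuous functions. -/
theorem exists_isFixedPt_of_iterate {E : Type*} [NormedAddCommGroup E] [CompleteSpace E] {Φ : (ℝ →ᵇ E) → (ℝ →ᵇ E)}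
    (hΦu : ∀ f, UniformContinuous (Φ f)) {n : ℕ} {q : ℝ} (hq0 : 0 ≤ q) (hq1 : q < 1)
    (hn : 1 ≤ n) (hlip : ∀ f g : ℝ →ᵇ E, UniformContinuous f → UniformContinuous g →
      dist (Φ^[n] f) (Φ^[n] g) ≤ q * dist f g) :
    ∃ u, Φ u = u ∧ ∀ v, Φ v = v → v = u := by
  have huc : ∀ f, UniformContinuous (Φ^[n] f) := by
    intro f
    obtain ⟨m, rfl⟩ := Nat.exists_eq_add_of_le' hn
    rw [Function.iterate_succ_apply']
    exact hΦu _
  have hcomplete := (isComplete_uniformContinuous (E := E)).completeSpace_coe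
  have hnonempty : Nonempty {f : ℝ →ᵇ E | UniformContinuous f} :=
    ⟨⟨0, uniformContinuous_const⟩⟩
  have hcontr : ContractingWith (Real.toNNReal q)
      (fun f : {f : ℝ →ᵇ E | UniformContinuous f} =>
        (⟨Φ^[n] f.1, huc f.1⟩ : {f : ℝ →ᵇ E | UniformContinuous f})) := by
    refine ⟨by simpa using hq1, LipschitzWith.of_dist_le_mul fun f g => ?_⟩
    rw [Real.coe_toNNReal _ hq0]
    exact hlip f.1 g.1 f.2 g.2
  obtain ⟨u, hu⟩ : ∃ u : ℝ →ᵇ E, Φ^[n] u = u :=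
    ⟨_, congrArg Subtype.val hcontr.fixedPoint_isFixedPt⟩
  have huniq : ∀ v w, Φ^[n] v = v → Φ^[n] w = w → v = w := by
    intro v w hv hw
    have h := hlip v w (hv ▸ huc v) (hw ▸ huc w)
    rw [hv, hw] at h
    exact dist_le_zero.1 (by nlinarith [dist_nonneg (x := v) (y := w)])
  refine ⟨u, huniq _ _ ?_ hu, fun v hv => huniq _ _ (Function.iterate_fixed hv n) hu⟩
  rw [← Function.iterate_succ_apply, Function.iterate_succ_apply', hu]

theorem integrable_indicator_Ioi {G : Type*} [NormedAddCommGroup G] {R : ℝ → G} {x : ℝ}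
    (hR : IntegrableOn R (Ioi x)) : Integrable ((Ioi x).indicator R) :=
  hR.integrable_indicator measurableSet_Ioi

/-! ### Mild solutions as fixed points -/

theorem setIntegral_Iio_eq_opConv (R : ℝ → E →L[ℂ] E) (g : ℝ → E) (t : ℝ) :
    ∫ s in Iio t, R (t - s) (g s) = opConv ((Ioi 0).indicator R) g t := by
  rw [← integral_indicator measurableSet_Iio, opConv]
  congr 1
  ext s
  by_cases hs : s ∈ Iio t
  · rw [indicator_of_mem hs, indicator_of_mem (mem_Ioi.2 (sub_pos.2 (mem_Iio.1 hs)))]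
  · rw [indicator_of_notMem hs,
      indicator_of_notMem (fun h => hs (mem_Iio.2 (sub_pos.1 (mem_Ioi.1 h))))]
    rfl

theorem integrableOn_Iio_kernel_apply {R : ℝ → E →L[ℂ] E} {g : ℝ → E} {t : ℝ}
    (h : Integrable fun s => (Ioi 0).indicator R (t - s) (g s)) :
    IntegrableOn (fun s => R (t - s) (g s)) (Iio t) := by
  refine (h.integrableOn (s := Iio t)).congr_fun (fun s hs => ?_) measurableSet_Iio
  simp only [indicator_of_mem (mem_Ioi.2 (sub_pos.2 (mem_Iio.1 hs)))]

end

end FracIncl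

end

/-! ### Existence, recurrence and uniqueness of the bounded mild solution. -/

theorem theorem3p1 {E : Type*} [NormedAddCommGroup E] [NormedSpace ℂ E] [CompleteSpace E]
    -- the closed multivalued linear operator, with condition (P), and the order of the derivative
    (A : Submodule ℂ (E × E)) (hA : IsClosed (A : Set (E × E)))
    (a M β : ℝ) (hP : FracIncl.ConditionP A a M β)
    (γ : ℝ) (hγ0 : 0 < γ) (hγ1 : γ < 1)
    -- the number `c` and the sequence `(αₙ)`
    (c : ℂ) (hc : ‖c‖ = 1)
    (α : ℕ → ℝ) (hα : FracIncl.IsRecurrenceSequence α)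
    (F : ℝ → E → E)
    (hFb : ∀ B : Set E, Bornology.IsBounded B →
      ∃ MB : ℝ, 0 < MB ∧ ∀ t : ℝ, ∀ y ∈ B, ‖F t y‖ ≤ MB)
    (p : ℝ) (hp : 1 < p) (hF : FracIncl.StepanovUR p c F)
    (r : ℝ) (hr : max p (p / (p - 1)) ≤ r)
    (LF : ℝ → ℝ) (hLF : FracIncl.MemStepanov r LF)
    (hLip : ∀ t : ℝ, ∀ x y : E, ‖F t x - F t y‖ ≤ LF t * ‖x - y‖)
    (q : ℝ) (hq : q = p * r / (p + r)) (hq1 : 1 < q)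
    (hγq : (γ - 1) * q / (q - 1) > -1)
    (hM : ∃ n : ℕ, 1 ≤ n ∧ FracIncl.kernelConst (FracIncl.fracResolvent A a γ) LF n < 1)
    (hFα : ∀ B : Set E, Bornology.IsBounded B → FracIncl.StepanovRecurrentAlong α p c F B) :
    ∃ u : ℝ → E,
      FracIncl.IsMildSolution A a γ F u ∧ u ∈ FracIncl.BUR α c ∧ u ∈ FracIncl.UR (1 : ℂ) ∧
      ∀ v : ℝ → E, FracIncl.IsMildSolution A a γ F v →
        Bornology.IsBounded (Set.range v) → v = u := by
  open FracIncl MeasureTheory Set Filter BoundedContinuousFunction in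
  have hFL : IsLipschitzNonlinearity F LF :=
    { meas := fun x => (hF.1 x).aestronglyMeasurable
      bdd := fun B hB => (hFb B hB).imp fun C hC => hC.2
      lip := hLip
      meas_modulus := hLF.1.aestronglyMeasurable
      modulus_le := hLF.exists_lintegral_le (hp.trans_le ((le_max_left _ _).trans hr)) }
  have hk : Integrable ((Ioi 0).indicator (fracResolvent A a γ)) :=
    integrable_indicator_Ioi (hP.integrableOn_fracResolvent hγ0 hγ1)
  choose Φ hΦu hΦ using hFL.exists_convolution hk
  obtain ⟨n, hn1, hn⟩ := hM
  have hn_top := (hn.trans ENNReal.one_lt_top).ne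
  have hq0 : (kernelConst (fracResolvent A a γ) LF n).toReal < 1 := by
    simpa using (ENNReal.toReal_lt_toReal hn_top ENNReal.one_ne_top).2 hn
  have hlip : ∀ f g : ℝ →ᵇ E, UniformContinuous f → UniformContinuous g →
      dist (Φ^[n] f) (Φ^[n] g) ≤ (kernelConst (fracResolvent A a γ) LF n).toReal * dist f g :=
    fun f g hf hg => hFL.dist_iterate_le hp hc hα.tendsto hFα hk hΦ hΦu hn_top hf hg
  obtain ⟨u, hu, huniq⟩ := exists_isFixedPt_of_iterate hΦu ENNReal.toReal_nonneg hq0 hn1 hlip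
  have huc : UniformContinuous u := hu ▸ hΦu u
  have hun : Φ^[n] u = u := Function.iterate_fixed hu n
  -- With `K` the contraction constant, `dist (σ_j u) u` is at most the commutation error plus `K *
  -- dist (σ_j u) u`; solving for it gives the factor `1/(1 - K)`.
  have hdist : Tendsto (fun j => dist (twistedShift c (α j) u) u) atTop (𝓝 0) := by
    have h := (hFL.tendsto_dist_twistedShift_iterate hp hc hFα hk hΦ hΦu huc n).div_const
      (1 - (kernelConst (fracResolvent A a γ) LF n).toReal)
    rw [zero_div] at h
    refine squeeze_zero (fun _ => dist_nonneg) (fun j => ?_) h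
    have hσ : UniformContinuous (twistedShift c (α j) u) :=
      (huc.comp (uniformContinuous_id.sub uniformContinuous_const)).const_smul c
    have h1 := hlip _ _ hσ huc
    have h2 := dist_triangle (twistedShift c (α j) u) (Φ^[n] (twistedShift c (α j) u)) u
    rw [hun] at h1 ⊢
    rw [le_div_iff₀ (by linarith)]
    linarith
  have hrec : RecurrentAlong α c u := by
    refine tendsto_iSup_enorm_of_le (fun j t => ?_) hdist
    have h := dist_coe_le_dist (f := twistedShift c (α j) u) (g := u) (t + α j)
    rwa [twistedShift_apply, add_sub_cancel_right, dist_comm, dist_eq_norm] at h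
  have hBUR : (u : ℝ → E) ∈ BUR α c := ⟨⟨u.continuous, α, hα, hrec⟩, u.isBounded_range, hrec⟩
  refine ⟨u, ⟨u.continuous, fun t => ⟨?_, ?_⟩⟩, hBUR, mem_UR_one_of_mem_BUR hα hc hBUR,
    fun v hv hvb => ?_⟩
  · obtain ⟨C, hC⟩ := hFL.exists_bound_comp ‖u‖
    exact integrableOn_Iio_kernel_apply (integrable_kernel_apply hk
      (hFL.aestronglyMeasurable_comp u.continuous) (hC u u.norm_coe_le_norm) t)
  · rw [setIntegral_Iio_eq_opConv, ← hΦ, hu]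
  · obtain ⟨C, hC⟩ := hvb.exists_norm_le
    set w : ℝ →ᵇ E := BoundedContinuousFunction.ofNormedAddCommGroup v hv.1 C
      fun t => hC _ (mem_range_self t) with hw
    have hwv : ∀ t, w t = v t := fun t => rfl
    have hfix : Φ w = w := by
      ext t
      rw [hΦ, ← setIntegral_Iio_eq_opConv, hwv, (hv.2 t).2]
      rfl
    rw [← huniq w hfix]
    rfl
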